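/- Let a \emph{cyclic surface} be a surface $\Sigma\subset\mathbb R^3$ swept out by a smooth one-parameter family of circles, i.e. the image of a smooth immersion $$X(s,\theta)=\mathbf c(s)+r(s)\bigl(\cos\theta\,\mathbf e_1(s)+\sin\theta\,\mathbf e_2(s)\bigr),\qquad s\in I,\ \theta\in\mathbb R,$$ where $I\subset\mathbb R$ is a nonempty open interval, $\mathbf c,\mathbf e_1,\mathbf e_2\colon I\to\mathbb R^3$ and $r\colon I\to(0,\infty)$ are smooth, and $\mathbf e_1(s),\mathbf e_2(s)$ are orthonormal for each $s$. Let $\nu=(\nu_1,\nu_2,\nu_3)$ be the unit normal of $\Sigma$. For the Dirichlet energy $\int_\Sigma F(\nu)\,d\Sigma$, $F(\nu)=\frac1{\nu_3}-\nu_3$, the anisotropic mean curvature is $\Lambda=2HF(\nu)-\operatorname{div}_\Sigma(DF(\nu))$ at the points with $\nu_3\ne0$, where $H$ is the mean curvature and $DF$ the gradient of $F$ on the unit sphere. The cyclic surface $\Sigma$ is called \emph{anisotropic minimal} if $\nu_3\neq0$ on a dense set of points $(s,\theta)\in I\times\mathbb R$ and $\Lambda=0$ at all points with $\nu_3\ne0$.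 A set $\Sigma\subset\mathbb R^3$ is a cyclic anisotropic minimal surface if and only if it is one of the following. (1) A surface of revolution about an axis parallel to the $z$-axis, namely a cyclic surface contained in a horizontal plane $z=z_0$ or, after a translation of $\mathbb R^3$, the surface $z=c\log\sqrt{x^2+y^2}$ with $c\neq0$ and $\sqrt{x^2+y^2}\in J$, where $J\subset(0,\infty)$ is a nonempty open interval. (2) After a translation of $\mathbb R^3$, the surface parametrized by $$X(s,\theta)=(a(s),b(s),s)+r(s)(\cos\theta,\sin\theta,0),\qquad s\in J,\ \theta\in\mathbb R,$$ where, for some $c,\lambda,\mu\in\mathbb R$ with $c\ne0$ and $\lambda^2+\mu^2\neq0$, the functions $a,b,r$ are given by one of the following, and $J$ is a nonempty open interval on which the denominators do not vanish ($r$ may be negative on $J$; the circle then has radius $|r|$): Type I: $\ r=\dfrac{c}{\sqrt{\lambda^2+\mu^2}\cos(cs)},\quad a=\dfrac{c\lambda\tan(cs)}{\lambda^2+\mu^2},\quad b=\dfrac{c\mu\tan(cs)}{\lambda^2+\mu^2}$; Type II: $\ r=\dfrac{1}{\sqrt{\lambda^2+\mu^2}\,s+c},\quad a=-\dfrac{\lambda}{(\lambda^2+\mu^2)s+c\sqrt{\lambda^2+\mu^2}},\quad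 b=-\dfrac{\mu}{(\lambda^2+\mu^2)s+c\sqrt{\lambda^2+\mu^2}}$; Type III: $\ r=\dfrac{c}{\sqrt{\lambda^2+\mu^2}\sinh(cs)},\quad a=-\dfrac{c\lambda\coth(cs)}{\lambda^2+\mu^2},\quad b=-\dfrac{c\mu\coth(cs)}{\lambda^2+\mu^2}$. (3) (Trivial case.) A cyclic surface contained in a plane that is neither horizontal nor vertical. -/

import Mathlib

open scoped ContDiff RealInnerProductSpace

noncomputable section

namespace DirichletCyclic

/-- Euclidean space `ℝ³`; the coordinates `x, y, z` are `p 0, p 1, p 2`. -/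
abbrev E3 : Type := EuclideanSpace ℝ (Fin 3)

/-- The vector product of `ℝ³`. -/
def cross (u v : E3) : E3 :=
  !₂[u 1 * v 2 - u 2 * v 1, u 2 * v 0 - u 0 * v 2, u 0 * v 1 - u 1 * v 0]

/-! ### Anisotropic mean curvature of a parametrized surface -/

/-- Partial derivative in the first variable `s`. -/
def ds (X : ℝ → ℝ → E3) (s θ : ℝ) : E3 := deriv (fun t => X t θ) s

/-- Partial derivative in the second variable `θ`. -/
def dθ (X : ℝ → ℝ → E3) (s θ : ℝ) : E3 := deriv (fun t => X s t) θ

/-- The unit normal `ν = X_s × X_θ / |X_s × X_θ|`. -/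
def unitNormal (X : ℝ → ℝ → E3) (s θ : ℝ) : E3 :=
  ‖cross (ds X s θ) (dθ X s θ)‖⁻¹ • cross (ds X s θ) (dθ X s θ)

/-- Determinant of the first fundamental form. -/
def detG (X : ℝ → ℝ → E3) (s θ : ℝ) : ℝ :=
  ⟪ds X s θ, ds X s θ⟫ * ⟪dθ X s θ, dθ X s θ⟫ - ⟪ds X s θ, dθ X s θ⟫ ^ 2

/-- The trace `∑ g^{ij} β_{ij}` with respect to the first fundamental form, where
`β` has the entries `b₁₁, b₁₂, b₂₁, b₂₂` in the basis `X_s, X_θ`. -/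
def metricTrace (X : ℝ → ℝ → E3) (s θ b₁₁ b₁₂ b₂₁ b₂₂ : ℝ) : ℝ :=
  (⟪dθ X s θ, dθ X s θ⟫ * b₁₁ - ⟪ds X s θ, dθ X s θ⟫ * (b₁₂ + b₂₁)
    + ⟪ds X s θ, ds X s θ⟫ * b₂₂) / detG X s θ

/-- The mean curvature `H`: half the trace of the second fundamental form
`h(X_i, X_j) = ⟨ν, X_{ij}⟩`. -/
def meanCurvature (X : ℝ → ℝ → E3) (s θ : ℝ) : ℝ :=
  metricTrace X s θ
    ⟪unitNormal X s θ, ds (ds X) s θ⟫ ⟪unitNormal X s θ, ds (dθ X) s θ⟫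
    ⟪unitNormal X s θ, dθ (ds X) s θ⟫ ⟪unitNormal X s θ, dθ (dθ X) s θ⟫ / 2

/-- The surface divergence `div_Σ V = ∑ g^{ij} ⟨V_i, X_j⟩` of a vector field `V` along `X`. -/
def surfaceDiv (X V : ℝ → ℝ → E3) (s θ : ℝ) : ℝ :=
  metricTrace X s θ
    ⟪ds V s θ, ds X s θ⟫ ⟪ds V s θ, dθ X s θ⟫
    ⟪dθ V s θ, ds X s θ⟫ ⟪dθ V s θ, dθ X s θ⟫

/-- The gradient on the unit sphere, at `n`, of the restriction of `F` to the sphere. -/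
def sphereGradient (F : E3 → ℝ) (n : E3) : E3 :=
  gradient F n - ⟪gradient F n, n⟫ • n

/-- The anisotropic mean curvature `Λ = 2 H F(ν) - div_Σ (DF(ν))` for the energy `∫ F(ν) dΣ`. -/
def anisotropicMeanCurvature (F : E3 → ℝ) (X : ℝ → ℝ → E3) (s θ : ℝ) : ℝ :=
  2 * meanCurvature X s θ * F (unitNormal X s θ)
    - surfaceDiv X (fun s' θ' => sphereGradient F (unitNormal X s' θ')) s θ

/-- The integrand of the Dirichlet energy, `F(ν) = 1/ν₃ - ν₃`, meaningful for `ν₃ ≠ 0`. -/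
def dirichletIntegrand (n : E3) : ℝ := 1 / n 2 - n 2

/-! ### Cyclic surfaces -/

/-- `X(s,θ) = 𝐜(s) + r(s) (cos θ 𝐞₁(s) + sin θ 𝐞₂(s))`. -/
def circleFamily (center e₁ e₂ : ℝ → E3) (r : ℝ → ℝ) (s θ : ℝ) : E3 :=
  center s + r s • (Real.cos θ • e₁ s + Real.sin θ • e₂ s)

/-- A nonempty open interval of `ℝ` (possibly unbounded). -/
def IsOpenInterval (I : Set ℝ) : Prop := IsOpen I ∧ I.OrdConnected ∧ I.Nonempty

/-- A cyclic surface: a surface immersed in `ℝ³` that is swept out by a smooth one-parameter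
family of circles. The circle of parameter `s` has centre `center s` and radius `radius s`, and
lies in the plane through its centre spanned by the orthonormal vectors `e₁ s`, `e₂ s`. -/
structure CyclicSurface where
  I : Set ℝ
  center : ℝ → E3
  radius : ℝ → ℝ
  e₁ : ℝ → E3
  e₂ : ℝ → E3
  interval : IsOpenInterval I
  center_smooth : ContDiffOn ℝ ∞ center I
  radius_smooth : ContDiffOn ℝ ∞ radius I
  e₁_smooth : ContDiffOn ℝ ∞ e₁ I
  e₂_smooth : ContDiffOn ℝ ∞ e₂ I
  radius_pos : ∀ s ∈ I, 0 < radius s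
  orthonormal : ∀ s ∈ I, Orthonormal ℝ ![e₁ s, e₂ s]
  immersion : ∀ s ∈ I, ∀ θ : ℝ,
    LinearIndependent ℝ ![ds (circleFamily center e₁ e₂ radius) s θ,
      dθ (circleFamily center e₁ e₂ radius) s θ]

namespace CyclicSurface

/-- The parametrization of the surface by `I × ℝ`. -/
def X (C : CyclicSurface) : ℝ → ℝ → E3 := circleFamily C.center C.e₁ C.e₂ C.radius

/-- The point set of the surface. -/
def carrier (C : CyclicSurface) : Set E3 := {p | ∃ s ∈ C.I, ∃ θ : ℝ, p = C.X s θ}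

/-- The parameters at which `ν₃ ≠ 0`, i.e. at which the Dirichlet integrand is defined. -/
def regular (C : CyclicSurface) : Set (ℝ × ℝ) :=
  {q | q.1 ∈ C.I ∧ unitNormal C.X q.1 q.2 2 ≠ 0}

/-- Anisotropic minimal surface of the Dirichlet energy: `ν₃ ≠ 0` on a dense set of parameters,
and the anisotropic mean curvature vanishes wherever `ν₃ ≠ 0`. -/
def IsAnisotropicMinimal (C : CyclicSurface) : Prop :=
  C.I ×ˢ Set.univ ⊆ closure C.regular ∧
    ∀ q ∈ C.regular, anisotropicMeanCurvature dirichletIntegrand C.X q.1 q.2 = 0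

end CyclicSurface

/-- `S` is (the point set of) a cyclic surface. -/
def IsCyclic (S : Set E3) : Prop := ∃ C : CyclicSurface, C.carrier = S

/-- `S` is (the point set of) a cyclic anisotropic minimal surface of the Dirichlet energy. -/
def IsCyclicAnisotropicMinimal (S : Set E3) : Prop :=
  ∃ C : CyclicSurface, C.IsAnisotropicMinimal ∧ C.carrier = S

/-! ### The surfaces of the classification -/

/-- The surface obtained by rotating the curve `z = u(ρ)`, `ρ ∈ J`, about the `z`-axis and then
translating by `v`. -/
def revolution (v : E3) (J : Set ℝ) (u : ℝ → ℝ) : Set E3 :=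
  {p | ∃ ρ ∈ J, ∃ θ : ℝ, p = v + !₂[ρ * Real.cos θ, ρ * Real.sin θ, u ρ]}

/-- The translate by `v` of the surface parametrized by
`X(s,θ) = (a(s), b(s), s) + r(s) (cos θ, sin θ, 0)`, `s ∈ J`. -/
def horizontalCircles (v : E3) (J : Set ℝ) (a b r : ℝ → ℝ) : Set E3 :=
  {p | ∃ s ∈ J, ∃ θ : ℝ,
    p = v + (!₂[a s, b s, s] + r s • !₂[Real.cos θ, Real.sin θ, 0])}

/-- `S` is a part, swept out by circles, of a horizontal plane. -/
def IsHorizontalPlanePiece (S : Set E3) : Prop :=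
  IsCyclic S ∧ ∃ z₀ : ℝ, ∀ p ∈ S, p 2 = z₀

/-- `S` is a part, swept out by circles, of a plane that is neither horizontal nor vertical. -/
def IsInclinedPlanePiece (S : Set E3) : Prop :=
  IsCyclic S ∧ ∃ A B z₀ : ℝ, (A, B) ≠ (0, 0) ∧ ∀ p ∈ S, p 2 = A * p 0 + B * p 1 + z₀

/-- After a translation, `S` is the surface of revolution `z = c log √(x² + y²)`, `c ≠ 0`, over
an open interval of radii. -/
def IsLogarithmicRevolution (S : Set E3) : Prop :=
  ∃ c : ℝ, c ≠ 0 ∧ ∃ J : Set ℝ, IsOpenInterval J ∧ J ⊆ Set.Ioi 0 ∧ ∃ v : E3,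
    S = revolution v J (fun ρ => c * Real.log ρ)

/-- Type I. -/
def IsTypeI (S : Set E3) : Prop :=
  ∃ c l m : ℝ, c ≠ 0 ∧ l ^ 2 + m ^ 2 ≠ 0 ∧ ∃ J : Set ℝ, IsOpenInterval J ∧
    (∀ s ∈ J, Real.cos (c * s) ≠ 0) ∧ ∃ v : E3,
    S = horizontalCircles v J
      (fun s => c * l * Real.tan (c * s) / (l ^ 2 + m ^ 2))
      (fun s => c * m * Real.tan (c * s) / (l ^ 2 + m ^ 2))
      (fun s => c / (Real.sqrt (l ^ 2 + m ^ 2) * Real.cos (c * s)))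

/-- Type II. -/
def IsTypeII (S : Set E3) : Prop :=
  ∃ c l m : ℝ, c ≠ 0 ∧ l ^ 2 + m ^ 2 ≠ 0 ∧ ∃ J : Set ℝ, IsOpenInterval J ∧
    (∀ s ∈ J, Real.sqrt (l ^ 2 + m ^ 2) * s + c ≠ 0) ∧ ∃ v : E3,
    S = horizontalCircles v J
      (fun s => -(l / ((l ^ 2 + m ^ 2) * s + c * Real.sqrt (l ^ 2 + m ^ 2))))
      (fun s => -(m / ((l ^ 2 + m ^ 2) * s + c * Real.sqrt (l ^ 2 + m ^ 2))))
      (fun s => 1 / (Real.sqrt (l ^ 2 + m ^ 2) * s + c))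

/-- Type III; here `coth = cosh / sinh`. -/
def IsTypeIII (S : Set E3) : Prop :=
  ∃ c l m : ℝ, c ≠ 0 ∧ l ^ 2 + m ^ 2 ≠ 0 ∧ ∃ J : Set ℝ, IsOpenInterval J ∧
    (∀ s ∈ J, Real.sinh (c * s) ≠ 0) ∧ ∃ v : E3,
    S = horizontalCircles v J
      (fun s => -(c * l * (Real.cosh (c * s) / Real.sinh (c * s)) / (l ^ 2 + m ^ 2)))
      (fun s => -(c * m * (Real.cosh (c * s) / Real.sinh (c * s)) / (l ^ 2 + m ^ 2)))
      (fun s => c / (Real.sqrt (l ^ 2 + m ^ 2) * Real.sinh (c * s)))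

end DirichletCyclic

end

open scoped ContDiff RealInnerProductSpace

namespace DirichletCyclic

/-! Where the surface is a graph z = u(x, y), the area element is dx dy / |ν₃|, so up to orientation
the energy ∫ F(ν) dΣ is ∫ |∇u|² dx dy. Hence Λ = 0 says that the height is a harmonic function of
(x, y). In a parametrization this becomes the vanishing of `heightLaplacian`, an expression
polynomial in the first and second derivatives of X (`anisotropicMeanCurvature_eq_zero_iff`). For a
minimal cyclic surface it vanishes, by continuity and density, at the parameters with ν₃ = 0 as
well.

For a family of circles, `heightLaplacian` is a trigonometric polynomial of degree 5 in θ. With m =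
e₁ - i e₂ and n = e₁ × e₂, its top coefficient is a nonzero multiple of m₃² (⟨e₁', n⟩ - i ⟨e₂',
n⟩)³. So at each s either the circle is horizontal or n' = 0. In both cases n₃' = 0; therefore the
circles are all horizontal or none is, and in both cases the planes are parallel.

Parallel planes that are not horizontal: if the planes move, the coefficients of degrees 3 and 2
force a vertical translation of a circle of constant radius, for which ν₃ = 0, against density. So
all circles lie in one plane, which is inclined.

Horizontal planes, with centre (a, b, z): the Fourier coefficients give three ordinary differential
equations. If z' vanishes once, it vanishes identically, since r' ≠ 0 there turns the radial
equation into a linear homogeneous one for z'; this is the horizontal plane. Otherwise z serves as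
parameter, a' = l r² z' and b' = m r² z'. The case l = m = 0 integrates to the logarithm. In the
other cases y = 1/r satisfies y y'' = y'² - k² with k² = l² + m² and derivatives in z. The first
integral (y'² - k²)/y² = κ gives y'' = κ y, and the sign of κ separates the types I, II, III.

Conversely, planes have vanishing second fundamental form, and the explicit profiles are checked
against the same differential equations. -/

/-! ### Coordinates, vector products and derivatives in ℝ³. -/

theorem inner_coord (u v : E3) : ⟪u, v⟫ = u 0 * v 0 + u 1 * v 1 + u 2 * v 2 := by
  simp [PiLp.inner_apply, Fin.sum_univ_three, mul_comm]

@[simp] theorem cross_zero (u v : E3) : cross u v 0 = u 1 * v 2 - u 2 * v 1 := rfl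
@[simp] theorem cross_one (u v : E3) : cross u v 1 = u 2 * v 0 - u 0 * v 2 := rfl
@[simp] theorem cross_two (u v : E3) : cross u v 2 = u 0 * v 1 - u 1 * v 0 := rfl

theorem E3.ext' {u v : E3} (h0 : u 0 = v 0) (h1 : u 1 = v 1) (h2 : u 2 = v 2) : u = v := by
  ext i; fin_cases i <;> assumption

theorem HasDerivAt.coord {f : ℝ → E3} {f' : E3} {t : ℝ} (hf : HasDerivAt f f' t) (i : Fin 3) :
    HasDerivAt (fun τ => f τ i) (f' i) t := by
  have := ((EuclideanSpace.proj i : E3 →L[ℝ] ℝ).hasFDerivAt (x := f t)).comp_hasDerivAt t hf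
  exact this

theorem hasDerivAt_of_coord {f : ℝ → E3} {f' : E3} {t : ℝ}
    (hf : ∀ i, HasDerivAt (fun τ => f τ i) (f' i) t) : HasDerivAt f f' t := by
  rw [hasDerivAt_iff_hasFDerivAt, ← hasFDerivWithinAt_univ, hasFDerivWithinAt_euclidean]
  intro i
  exact ((hf i).hasFDerivAt.congr_fderiv (by ext; simp)).hasFDerivWithinAt

theorem HasDerivAt.cross {f g : ℝ → E3} {f' g' : E3} {t : ℝ} (hf : HasDerivAt f f' t)
    (hg : HasDerivAt g g' t) :
    HasDerivAt (fun τ => cross (f τ) (g τ)) (cross f' (g t) + cross (f t) g') t := by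
  apply hasDerivAt_of_coord
  intro i
  have a := fun i => HasDerivAt.coord hf i
  have b := fun i => HasDerivAt.coord hg i
  fin_cases i
  · exact (((a 1).mul (b 2)).sub ((a 2).mul (b 1))).congr_deriv (by simp; ring)
  · exact (((a 2).mul (b 0)).sub ((a 0).mul (b 2))).congr_deriv (by simp; ring)
  · exact (((a 0).mul (b 1)).sub ((a 1).mul (b 0))).congr_deriv (by simp; ring)

/-! ### Vanishing anisotropic mean curvature as harmonicity of the height. -/

theorem gradient_dirichletIntegrand {n : E3} (hn : n 2 ≠ 0) :
    gradient dirichletIntegrand n = !₂[0, 0, -(1 / n 2 ^ 2 + 1)] := by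
  apply HasGradientAt.gradient
  rw [hasGradientAt_iff_hasFDerivAt]
  have h1 : HasDerivAt (fun x : ℝ => 1 / x - x) (-(1 / n 2 ^ 2 + 1)) (n 2) := by
    have := (hasDerivAt_inv hn).sub (hasDerivAt_id (n 2))
    simp only [one_div]
    exact this.congr_deriv (by ring)
  have h2 := HasDerivAt.comp_hasFDerivAt (h₂ := fun x : ℝ => 1 / x - x)
    (f := fun m : E3 => m 2) n h1 ((EuclideanSpace.proj 2 : E3 →L[ℝ] ℝ).hasFDerivAt (x := n))
  refine HasFDerivAt.congr_fderiv (f := dirichletIntegrand) h2 ?_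
  ext v
  simp [inner_coord]

theorem sphereGradient_dirichletIntegrand {n : E3} (hn : n 2 ≠ 0) :
    sphereGradient dirichletIntegrand n =
      (1 / n 2 + n 2) • n - (1 / n 2 ^ 2 + 1) • !₂[0, 0, 1] := by
  rw [sphereGradient, gradient_dirichletIntegrand hn]
  apply E3.ext' <;> simp [inner_coord] <;> field_simp
  all_goals ring

theorem norm_sq_coord (u : E3) : ‖u‖ ^ 2 = u 0 ^ 2 + u 1 ^ 2 + u 2 ^ 2 := by
  rw [← real_inner_self_eq_norm_sq, inner_coord]; ring

/-- With N = u × v, the vectors v × N and N × u are |N|² times the basis dual to u, v in their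
plane. This recovers the vertical component of the derivative of ν from its products with the
tangent vectors. -/
theorem norm_sq_smul_eq_dual (w u v : E3) :
    ‖cross u v‖ ^ 2 • w = ⟪w, u⟫ • cross v (cross u v) + ⟪w, v⟫ • cross (cross u v) u
      + ⟪w, cross u v⟫ • cross u v := by
  apply E3.ext' <;> simp [inner_coord, norm_sq_coord] <;> ring

/-- The unit normal along a curve of frames, and the derivative of its vertical component. -/
theorem hasDerivAt_normalized_cross {A B : ℝ → E3} {A' B' : E3} {t : ℝ} (hA : HasDerivAt A A' t)
    (hB : HasDerivAt B B' t) (h0 : cross (A t) (B t) ≠ 0) :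
    ∃ ν' : E3, HasDerivAt (fun τ => ‖cross (A τ) (B τ)‖⁻¹ • cross (A τ) (B τ)) ν' t ∧
      ⟪ν', A t⟫ = -⟪‖cross (A t) (B t)‖⁻¹ • cross (A t) (B t), A'⟫ ∧
      ⟪ν', B t⟫ = -⟪‖cross (A t) (B t)‖⁻¹ • cross (A t) (B t), B'⟫ ∧
      ⟪ν', cross (A t) (B t)⟫ = 0 := by
  have hN := HasDerivAt.cross hA hB
  have hnn : DifferentiableAt ℝ (fun τ => ‖cross (A τ) (B τ)‖) t :=
    hN.differentiableAt.norm ℝ h0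
  have hd := (hnn.inv (norm_ne_zero_iff.2 h0)).smul hN.differentiableAt
  refine ⟨_, hd.hasDerivAt, ?_, ?_, ?_⟩
  -- The normal is orthogonal to A for every τ, even where the cross product vanishes, since the
  -- inverse of 0 is 0; differentiating moves the derivative onto A.
  · have h := hd.hasDerivAt.inner ℝ hA
    have hz : (fun τ => ⟪((fun τ => ‖cross (A τ) (B τ)‖)⁻¹ • fun τ => cross (A τ) (B τ)) τ, A τ⟫)
        = fun _ => (0 : ℝ) := by
      funext τ; simp [inner_coord]; ring
    rw [hz] at h
    have := h.unique (hasDerivAt_const t 0)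
    simp only [Pi.smul_apply', Pi.inv_apply] at this
    linarith
  · have h := hd.hasDerivAt.inner ℝ hB
    have hz : (fun τ => ⟪((fun τ => ‖cross (A τ) (B τ)‖)⁻¹ • fun τ => cross (A τ) (B τ)) τ, B τ⟫)
        = fun _ => (0 : ℝ) := by
      funext τ; simp [inner_coord]; ring
    rw [hz] at h
    have := h.unique (hasDerivAt_const t 0)
    simp only [Pi.smul_apply', Pi.inv_apply] at this
    linarith
  -- Differentiate |ν|² = 1, which holds only near t, where the cross product is nonzero.
  · have h := hd.hasDerivAt.inner ℝ hd.hasDerivAt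
    have hz : (fun τ => ⟪((fun τ => ‖cross (A τ) (B τ)‖)⁻¹ • fun τ => cross (A τ) (B τ)) τ,
        ((fun τ => ‖cross (A τ) (B τ)‖)⁻¹ • fun τ => cross (A τ) (B τ)) τ⟫)
        =ᶠ[nhds t] fun _ => (1 : ℝ) := by
      filter_upwards [hN.continuousAt.eventually_ne h0] with τ hτ
      have : ‖cross (A τ) (B τ)‖ ≠ 0 := norm_ne_zero_iff.2 hτ
      simp only [Pi.smul_apply', Pi.inv_apply]
      rw [real_inner_smul_left, real_inner_smul_right, real_inner_self_eq_norm_sq]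
      field_simp
    have := (h.congr_of_eventuallyEq hz.symm).unique (hasDerivAt_const t 1)
    rw [real_inner_comm] at this
    simp only [Pi.smul_apply', Pi.inv_apply, real_inner_smul_right] at this
    have h1 : ‖cross (A t) (B t)‖⁻¹ ≠ 0 := inv_ne_zero (norm_ne_zero_iff.2 h0)
    rw [← two_mul] at this
    simpa [h1, norm_ne_zero_iff.2 h0, h0] using this

/-- The pairing of the derivative of `DF(ν)` with a tangent vector, for the Dirichlet integrand. -/
theorem inner_deriv_sphereGradient {A B : ℝ → E3} {A' B' : E3} {t : ℝ} (hA : HasDerivAt A A' t)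
    (hB : HasDerivAt B B' t) {ν N : E3} (hN : N = cross (A t) (B t)) (hν : ν = ‖N‖⁻¹ • N)
    (h2 : ν 2 ≠ 0) {V : ℝ → E3}
    (hV : V = fun τ => sphereGradient dirichletIntegrand
      (‖cross (A τ) (B τ)‖⁻¹ • cross (A τ) (B τ))) :
    ⟪deriv V t, A t⟫ = -(1 / ν 2 + ν 2) * ⟪ν, A'⟫ - 2 / ν 2 ^ 3 *
        ((⟪ν, A'⟫ * cross (B t) N 2 + ⟪ν, B'⟫ * cross N (A t) 2) / ‖N‖ ^ 2) * A t 2 ∧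
    ⟪deriv V t, B t⟫ = -(1 / ν 2 + ν 2) * ⟪ν, B'⟫ - 2 / ν 2 ^ 3 *
        ((⟪ν, A'⟫ * cross (B t) N 2 + ⟪ν, B'⟫ * cross N (A t) 2) / ‖N‖ ^ 2) * B t 2 := by
  have h0 : cross (A t) (B t) ≠ 0 := by
    rintro h
    apply h2
    rw [hν, hN, h]; simp
  obtain ⟨ν', hν', hνA, hνB, hνN⟩ := hasDerivAt_normalized_cross hA hB h0
  have hd := norm_sq_smul_eq_dual ν' (A t) (B t)
  rw [hνN, hνA, hνB, zero_smul, add_zero, ← hN, ← hν] at hd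
  have hL : ‖N‖ ≠ 0 := by rw [hN]; exact norm_ne_zero_iff.2 h0
  have h3 : ν' 2 = -((⟪ν, A'⟫ * cross (B t) N 2 + ⟪ν, B'⟫ * cross N (A t) 2) / ‖N‖ ^ 2) := by
    have := congrArg (fun u : E3 => u 2) hd
    simp only [PiLp.smul_apply, PiLp.add_apply, smul_eq_mul] at this
    field_simp
    linarith
  have hνt : ‖cross (A t) (B t)‖⁻¹ • cross (A t) (B t) = ν := by rw [hν, hN]
  have hc := HasDerivAt.coord hν' 2
  have h2' : (‖cross (A t) (B t)‖⁻¹ • cross (A t) (B t)) 2 ≠ 0 := by rwa [hνt]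
  have hev : V =ᶠ[nhds t] fun τ =>
      (1 / (‖cross (A τ) (B τ)‖⁻¹ • cross (A τ) (B τ)) 2 +
        (‖cross (A τ) (B τ)‖⁻¹ • cross (A τ) (B τ)) 2) •
        (‖cross (A τ) (B τ)‖⁻¹ • cross (A τ) (B τ)) -
      (1 / (‖cross (A τ) (B τ)‖⁻¹ • cross (A τ) (B τ)) 2 ^ 2 + 1) • !₂[0, 0, 1] := by
    filter_upwards [hc.continuousAt.eventually_ne h2'] with τ hτ
    rw [hV]
    exact sphereGradient_dirichletIntegrand hτ
  have hi := hc.fun_inv h2'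
  have hq := (hc.pow 2).fun_inv (pow_ne_zero 2 h2')
  have hder := ((hi.add hc).smul hν').sub ((hq.add_const 1).smul_const (!₂[0, 0, 1] : E3))
  have hder' : HasDerivAt V _ t := (hder.congr_of_eventuallyEq (hev.trans
    (Filter.Eventually.of_forall fun τ => by simp)))
  have hAν : ⟪ν, A t⟫ = 0 := by rw [hν, hN]; simp [inner_coord]; ring
  have hBν : ⟪ν, B t⟫ = 0 := by rw [hν, hN]; simp [inner_coord]; ring
  rw [hder'.deriv]
  simp only [Pi.add_apply, Pi.pow_apply, hνt, inner_sub_left, inner_add_left,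
    real_inner_smul_left, hνA, hνB, hAν, hBν]
  rw [← neg_eq_iff_eq_neg.2 h3]
  have e3 : ∀ u : E3, ⟪(!₂[0, 0, 1] : E3), u⟫ = u 2 := fun u => by simp [inner_coord]
  rw [e3, e3]
  constructor <;> field_simp <;> ring

/-- The Euclidean product of the horizontal parts. -/
noncomputable def horizontalInner (u v : E3) : ℝ := u 0 * v 0 + u 1 * v 1

/-- Up to a factor, the Laplacian of the height function of a surface with first derivatives
`A, B` and second derivatives `Ass, Ast, Ats, Att`. -/
noncomputable def heightLaplacian (A B Ass Ast Ats Att : E3) : ℝ :=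
  horizontalInner B B * ⟪cross A B, Ass⟫
    - horizontalInner A B * (⟪cross A B, Ast⟫ + ⟪cross A B, Ats⟫)
    + horizontalInner A A * ⟪cross A B, Att⟫

/-- In fact Λ equals 2/n³ times `heightLaplacian`, where n is the vertical component of X_s × X_θ.
The result is free of square roots and denominators, hence polynomial in the derivatives of X. -/
theorem anisotropicMeanCurvature_eq_zero_iff {X : ℝ → ℝ → E3} {s θ : ℝ} {Ass Ast Ats Att : E3}
    (hss : HasDerivAt (fun t => ds X t θ) Ass s) (hts : HasDerivAt (fun t => ds X s t) Ats θ)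
    (hst : HasDerivAt (fun t => dθ X t θ) Ast s) (htt : HasDerivAt (fun t => dθ X s t) Att θ)
    (h2 : unitNormal X s θ 2 ≠ 0) :
    anisotropicMeanCurvature dirichletIntegrand X s θ = 0 ↔
      heightLaplacian (ds X s θ) (dθ X s θ) Ass Ast Ats Att = 0 := by
  obtain ⟨s1, s2⟩ := inner_deriv_sphereGradient hss hst rfl rfl h2 rfl
  obtain ⟨t1, t2⟩ := inner_deriv_sphereGradient hts htt rfl rfl h2 rfl
  have hD : detG X s θ = ‖cross (ds X s θ) (dθ X s θ)‖ ^ 2 := by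
    simp only [detG, norm_sq_coord, inner_coord, cross_zero, cross_one, cross_two]; ring
  have e1 : ds (ds X) s θ = Ass := hss.deriv
  have e2 : dθ (ds X) s θ = Ats := hts.deriv
  have e3 : ds (dθ X) s θ = Ast := hst.deriv
  have e4 : dθ (dθ X) s θ = Att := htt.deriv
  have f1 : ds (fun s' θ' => sphereGradient dirichletIntegrand (unitNormal X s' θ')) s θ =
    deriv (fun t => sphereGradient dirichletIntegrand
      (‖cross (ds X t θ) (dθ X t θ)‖⁻¹ • cross (ds X t θ) (dθ X t θ))) s := rfl
  have f2 : dθ (fun s' θ' => sphereGradient dirichletIntegrand (unitNormal X s' θ')) s θ =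
    deriv (fun t => sphereGradient dirichletIntegrand
      (‖cross (ds X s t) (dθ X s t)‖⁻¹ • cross (ds X s t) (dθ X s t))) θ := rfl
  have hν : ∀ u, ⟪‖cross (ds X s θ) (dθ X s θ)‖⁻¹ • cross (ds X s θ) (dθ X s θ), u⟫ =
      ‖cross (ds X s θ) (dθ X s θ)‖⁻¹ * ⟪cross (ds X s θ) (dθ X s θ), u⟫ :=
    fun u => real_inner_smul_left _ _ _
  rw [anisotropicMeanCurvature, meanCurvature, surfaceDiv, f1, f2, e1, e2, e3, e4, metricTrace,
    metricTrace, s1, s2, t1, t2, hD, dirichletIntegrand]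
  have hun : unitNormal X s θ =
    ‖cross (ds X s θ) (dθ X s θ)‖⁻¹ • cross (ds X s θ) (dθ X s θ) := rfl
  rw [hun] at h2
  simp only [hun, hν, PiLp.smul_apply, smul_eq_mul] at h2 ⊢
  generalize ds X s θ = A at *
  generalize dθ X s θ = B at *
  have hL : ‖cross A B‖ ≠ 0 := fun h => h2 (by simp [h])
  have hN : cross A B 2 ≠ 0 := fun h => h2 (by rw [h]; simp)
  have hLL : ‖cross A B‖ ^ 2 = ⟪A, A⟫ * ⟪B, B⟫ - ⟪A, B⟫ ^ 2 := by
    simp only [norm_sq_coord, inner_coord, cross_zero, cross_one, cross_two]; ring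
  have m1 : cross B (cross A B) 2 = ⟪B, B⟫ * A 2 - ⟪A, B⟫ * B 2 := by
    simp only [inner_coord, cross_zero, cross_one, cross_two]; ring
  have m2 : cross (cross A B) A 2 = ⟪A, A⟫ * B 2 - ⟪A, B⟫ * A 2 := by
    simp only [inner_coord, cross_zero, cross_one, cross_two]; ring
  -- The metric induced by the projection to the horizontal plane is g - dz², with determinant n².
  -- These three identities express its cofactors through g and dz, which is how the two traces in Λ
  -- combine into one.
  have k11 : cross A B 2 ^ 2 * ⟪B, B⟫ + (⟪B, B⟫ * A 2 - ⟪A, B⟫ * B 2) ^ 2 =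
      ‖cross A B‖ ^ 2 * horizontalInner B B := by
    rw [hLL]; simp only [inner_coord, horizontalInner, cross_two]; ring
  have k12 : cross A B 2 ^ 2 * ⟪A, B⟫ - (⟪B, B⟫ * A 2 - ⟪A, B⟫ * B 2) *
      (⟪A, A⟫ * B 2 - ⟪A, B⟫ * A 2) = ‖cross A B‖ ^ 2 * horizontalInner A B := by
    rw [hLL]; simp only [inner_coord, horizontalInner, cross_two]; ring
  have k22 : cross A B 2 ^ 2 * ⟪A, A⟫ + (⟪A, A⟫ * B 2 - ⟪A, B⟫ * A 2) ^ 2 =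
      ‖cross A B‖ ^ 2 * horizontalInner A A := by
    rw [hLL]; simp only [inner_coord, horizontalInner, cross_two]; ring
  rw [m1, m2, heightLaplacian]
  generalize horizontalInner A A = h11 at *
  generalize horizontalInner A B = h12 at *
  generalize horizontalInner B B = h22 at *
  generalize ⟪A, A⟫ = g11 at *
  generalize ⟪A, B⟫ = g12 at *
  generalize ⟪B, B⟫ = g22 at *
  generalize ⟪cross A B, Ass⟫ = b11 at *
  generalize ⟪cross A B, Ast⟫ = b12 at *
  generalize ⟪cross A B, Ats⟫ = b21 at *
  generalize ⟪cross A B, Att⟫ = b22 at *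
  generalize cross A B 2 = n at *
  generalize ‖cross A B‖ = l at *
  generalize A 2 = x at *
  generalize B 2 = y at *
  have key : ∀ L R : ℝ, L = 2 / n ^ 3 * R → (L = 0 ↔ R = 0) := by
    rintro L R rfl
    simp [hN]
  apply key
  have : h22 = (n ^ 2 * g22 + (g22 * x - g12 * y) ^ 2) / l ^ 2 := by field_simp; linarith
  have : h12 = (n ^ 2 * g12 - (g22 * x - g12 * y) * (g11 * y - g12 * x)) / l ^ 2 := by
    field_simp; linarith
  have : h11 = (n ^ 2 * g11 + (g11 * y - g12 * x) ^ 2) / l ^ 2 := by field_simp; linarith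
  subst h22 h12 h11
  field_simp
  ring

/-! ### Trigonometric polynomials and their leading coefficients. -/

open Polynomial in
/-- `f` is a trigonometric polynomial of degree at most `n`, with coefficient `L` at `e^{inθ}`. -/
def HasLead (n : ℕ) (f : ℝ → ℝ) (L : ℂ) : Prop :=
  ∃ q : ℂ[X], q.natDegree ≤ 2 * n ∧ q.coeff (2 * n) = L ∧
    ∀ θ : ℝ, Complex.exp (θ * Complex.I) ^ n * (f θ : ℂ) = q.eval (Complex.exp (θ * Complex.I))

namespace HasLead

variable {n m : ℕ} {f g : ℝ → ℝ} {L M : ℂ}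

theorem add (hf : HasLead n f L) (hg : HasLead n g M) :
    HasLead n (fun θ => f θ + g θ) (L + M) := by
  obtain ⟨p, p1, p2, p3⟩ := hf
  obtain ⟨q, q1, q2, q3⟩ := hg
  refine ⟨p + q, (Polynomial.natDegree_add_le _ _).trans (max_le p1 q1), by simp [p2, q2], ?_⟩
  intro θ
  rw [Polynomial.eval_add, ← p3, ← q3]; push_cast; ring

theorem mul (hf : HasLead n f L) (hg : HasLead m g M) :
    HasLead (n + m) (fun θ => f θ * g θ) (L * M) := by
  obtain ⟨p, p1, p2, p3⟩ := hf
  obtain ⟨q, q1, q2, q3⟩ := hg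
  refine ⟨p * q, ?_, ?_, ?_⟩
  · refine Polynomial.natDegree_mul_le.trans ?_
    omega
  · rw [mul_add, Polynomial.coeff_mul_add_eq_of_natDegree_le p1 q1, p2, q2]
  · intro θ
    rw [Polynomial.eval_mul, ← p3, ← q3]; push_cast; ring

theorem const (a : ℝ) : HasLead 0 (fun _ => a) a :=
  ⟨Polynomial.C (a : ℂ), by simp, by simp, by simp⟩

theorem neg (hf : HasLead n f L) : HasLead n (fun θ => -f θ) (-L) := by
  have := (const (-1)).mul hf
  simpa using this

theorem sub (hf : HasLead n f L) (hg : HasLead n g M) :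
    HasLead n (fun θ => f θ - g θ) (L - M) := by
  simpa [sub_eq_add_neg] using hf.add hg.neg

theorem linear (a b c : ℝ) :
    HasLead 1 (fun θ => a + (b * Real.cos θ + c * Real.sin θ)) ((b - c * Complex.I) / 2) := by
  refine ⟨Polynomial.C ((b - c * Complex.I) / 2) * Polynomial.X ^ 2 + Polynomial.C (a : ℂ) *
    Polynomial.X + Polynomial.C ((b + c * Complex.I) / 2), Polynomial.natDegree_quadratic_le, ?_, ?_⟩
  · simp
  · intro θ
    have h : Complex.exp (θ * Complex.I) = Complex.cos θ + Complex.sin θ * Complex.I :=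
      Complex.exp_mul_I _
    simp only [Polynomial.eval_add, Polynomial.eval_mul, Polynomial.eval_C, Polynomial.eval_pow,
      Polynomial.eval_X, pow_one]
    push_cast
    rw [h]
    have h1 := Complex.sin_sq_add_cos_sq (θ : ℂ)
    have h2 := Complex.I_sq
    linear_combination ((b + c * Complex.I) / 2) * h1 +
      (-b * Complex.sin θ ^ 2 / 2 + c * Complex.cos θ * Complex.sin θ +
        c * Complex.I * Complex.sin θ ^ 2 / 2) * h2

/-- Lets terms of different degrees be added: multiplication by the constant 1, viewed as having
degree 1 with leading coefficient 0. -/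
theorem raise (hf : HasLead n f L) : HasLead (n + 1) f 0 := by
  have := (linear 1 0 0).mul hf
  rw [add_comm n 1]
  simpa using this

theorem congr (hf : HasLead n f L) (h : ∀ θ, f θ = g θ) (hL : L = M) : HasLead n g M := by
  rw [← hL, ← funext h]; exact hf

theorem eq_zero (hf : HasLead n f L) (h : ∀ θ, f θ = 0) : L = 0 := by
  obtain ⟨q, _, q2, q3⟩ := hf
  rw [← q2]
  suffices q = 0 by simp [this]
  apply Polynomial.eq_zero_of_infinite_isRoot
  -- The polynomial q vanishes on the unit circle. The arc over [0, 1] already supplies infinitely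
  -- many roots, because the cosine is injective there.
  refine Set.Infinite.mono (s := (fun θ : ℝ => Complex.exp (θ * Complex.I)) '' Set.Icc 0 1) ?_ ?_
  · rintro _ ⟨θ, _, rfl⟩
    have := q3 θ
    rw [h θ] at this
    simpa using this.symm
  · apply Set.Infinite.image _ (Set.Icc_infinite one_pos)
    intro x hx y hy hxy
    have := congrArg Complex.re hxy
    simp only [Complex.exp_ofReal_mul_I_re] at this
    refine Real.injOn_cos ⟨hx.1, hx.2.trans ?_⟩ ⟨hy.1, hy.2.trans ?_⟩ this <;>
      linarith [Real.pi_gt_three]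

end HasLead

/-! ### Derivatives of a circle family. -/

/-- The point at angle `θ` of the ellipse with conjugate half-diameters `u, v`. -/
noncomputable def rot (u v : E3) (θ : ℝ) : E3 := Real.cos θ • u + Real.sin θ • v

theorem rot_apply (u v : E3) (θ : ℝ) (i : Fin 3) :
    rot u v θ i = u i * Real.cos θ + v i * Real.sin θ := by
  simp [rot]; ring

theorem hasDerivAt_rot_angle (u v : E3) (θ : ℝ) : HasDerivAt (rot u v) (rot v (-u) θ) θ := by
  have := ((Real.hasDerivAt_cos θ).smul_const u).add ((Real.hasDerivAt_sin θ).smul_const v)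
  exact this.congr_deriv (by simp [rot, add_comm])

theorem hasDerivAt_rot {u v : ℝ → E3} {u' v' : E3} {s : ℝ} (hu : HasDerivAt u u' s)
    (hv : HasDerivAt v v' s) (θ : ℝ) : HasDerivAt (fun t => rot (u t) (v t) θ) (rot u' v' θ) s :=
  (hu.const_smul (Real.cos θ)).add (hv.const_smul (Real.sin θ))

theorem rot_neg (u v : E3) (θ : ℝ) : rot (-u) (-v) θ = -rot u v θ := by
  simp [rot]; abel

section Smooth

variable {F : Type*} [NormedAddCommGroup F] [NormedSpace ℝ F] {f : ℝ → F} {I : Set ℝ} {s : ℝ}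

theorem hasDerivAt_of_smooth (hf : ContDiffOn ℝ ∞ f I) (hI : IsOpen I) (hs : s ∈ I) :
    HasDerivAt f (deriv f s) s :=
  ((hf.differentiableOn (by simp)).differentiableAt (hI.mem_nhds hs)).hasDerivAt

theorem smooth_deriv (hf : ContDiffOn ℝ ∞ f I) (hI : IsOpen I) : ContDiffOn ℝ ∞ (deriv f) I :=
  ((contDiffOn_infty_iff_deriv_of_isOpen hI).1 hf).2

theorem continuousAt_fst_of_smooth (hf : ContDiffOn ℝ ∞ f I) (hI : IsOpen I) {q : ℝ × ℝ}
    (hq : q.1 ∈ I) : ContinuousAt (fun p : ℝ × ℝ => f p.1) q :=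
  ContinuousAt.comp (g := f) (hf.continuousOn.continuousAt (hI.mem_nhds hq)) continuousAt_fst

end Smooth

/-- The tangent vector `X_s` of a circle family. -/
noncomputable def tangentS (c₁ e₁ e₂ f₁ f₂ : E3) (r r₁ θ : ℝ) : E3 :=
  c₁ + (r₁ • rot e₁ e₂ θ + r • rot f₁ f₂ θ)

/-- The tangent vector `X_θ` of a circle family. -/
noncomputable def tangentθ (e₁ e₂ : E3) (r θ : ℝ) : E3 := r • rot e₂ (-e₁) θ

/-- The expression `heightLaplacian` for a circle family, in terms of the first and second
derivatives `c₁, c₂` of the centre, `r₁, r₂` of the radius and `f, g` of the frame `e`. -/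
noncomputable def circleLaplacian (c₁ c₂ e₁ e₂ f₁ f₂ g₁ g₂ : E3) (r r₁ r₂ θ : ℝ) : ℝ :=
  heightLaplacian (tangentS c₁ e₁ e₂ f₁ f₂ r r₁ θ) (tangentθ e₁ e₂ r θ)
    (c₂ + ((r₂ • rot e₁ e₂ θ + (2 * r₁) • rot f₁ f₂ θ) + r • rot g₁ g₂ θ))
    (r₁ • rot e₂ (-e₁) θ + r • rot f₂ (-f₁) θ)
    (r₁ • rot e₂ (-e₁) θ + r • rot f₂ (-f₁) θ)
    (-(r • rot e₁ e₂ θ))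

namespace CyclicSurface

variable (C : CyclicSurface)

/-- `circleLaplacian` at a parameter of a cyclic surface. -/
noncomputable def laplacian (s θ : ℝ) : ℝ :=
  circleLaplacian (deriv C.center s) (deriv (deriv C.center) s) (C.e₁ s) (C.e₂ s)
    (deriv C.e₁ s) (deriv C.e₂ s) (deriv (deriv C.e₁) s) (deriv (deriv C.e₂) s)
    (C.radius s) (deriv C.radius s) (deriv (deriv C.radius) s) θ

variable {C} {s : ℝ}

theorem ds_X (hs : s ∈ C.I) (θ : ℝ) :
    ds C.X s θ = tangentS (deriv C.center s) (C.e₁ s) (C.e₂ s) (deriv C.e₁ s) (deriv C.e₂ s)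
      (C.radius s) (deriv C.radius s) θ := by
  have hI := C.interval.1
  have h := (hasDerivAt_of_smooth C.center_smooth hI hs).add
    ((hasDerivAt_of_smooth C.radius_smooth hI hs).smul
      (hasDerivAt_rot (hasDerivAt_of_smooth C.e₁_smooth hI hs)
        (hasDerivAt_of_smooth C.e₂_smooth hI hs) θ))
  exact h.deriv.trans (by rw [tangentS, add_comm (C.radius s • _)])

theorem dθ_X (s θ : ℝ) : dθ C.X s θ = tangentθ (C.e₁ s) (C.e₂ s) (C.radius s) θ :=
  (((hasDerivAt_rot_angle (C.e₁ s) (C.e₂ s) θ).const_smul (C.radius s)).const_add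
    (C.center s)).deriv

theorem hasDerivAt_ds_s (hs : s ∈ C.I) (θ : ℝ) :
    HasDerivAt (fun t => ds C.X t θ) (deriv (deriv C.center) s +
      ((deriv (deriv C.radius) s • rot (C.e₁ s) (C.e₂ s) θ +
        (2 * deriv C.radius s) • rot (deriv C.e₁ s) (deriv C.e₂ s) θ) +
        C.radius s • rot (deriv (deriv C.e₁) s) (deriv (deriv C.e₂) s) θ)) s := by
  have hI := C.interval.1
  have h : (fun t => ds C.X t θ) =ᶠ[nhds s] fun t => tangentS (deriv C.center t) (C.e₁ t) (C.e₂ t)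
      (deriv C.e₁ t) (deriv C.e₂ t) (C.radius t) (deriv C.radius t) θ := by
    filter_upwards [hI.mem_nhds hs] with t ht using ds_X ht θ
  refine HasDerivAt.congr_of_eventuallyEq ?_ h
  have d1 := hasDerivAt_of_smooth C.e₁_smooth hI hs
  have d2 := hasDerivAt_of_smooth C.e₂_smooth hI hs
  have d1' := hasDerivAt_of_smooth (smooth_deriv C.e₁_smooth hI) hI hs
  have d2' := hasDerivAt_of_smooth (smooth_deriv C.e₂_smooth hI) hI hs
  have dr := hasDerivAt_of_smooth C.radius_smooth hI hs
  have dr' := hasDerivAt_of_smooth (smooth_deriv C.radius_smooth hI) hI hs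
  have dc' := hasDerivAt_of_smooth (smooth_deriv C.center_smooth hI) hI hs
  exact (dc'.add ((dr'.smul (hasDerivAt_rot d1 d2 θ)).add
    (dr.smul (hasDerivAt_rot d1' d2' θ)))).congr_deriv (by module)

theorem hasDerivAt_ds_θ (hs : s ∈ C.I) (θ : ℝ) :
    HasDerivAt (fun t => ds C.X s t) (deriv C.radius s • rot (C.e₂ s) (-C.e₁ s) θ +
        C.radius s • rot (deriv C.e₂ s) (-deriv C.e₁ s) θ) θ := by
  rw [funext fun t => ds_X hs t]
  exact (((hasDerivAt_rot_angle _ _ θ).const_smul (deriv C.radius s)).add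
    ((hasDerivAt_rot_angle _ _ θ).const_smul (C.radius s))).const_add _

theorem hasDerivAt_dθ_s (hs : s ∈ C.I) (θ : ℝ) :
    HasDerivAt (fun t => dθ C.X t θ) (deriv C.radius s • rot (C.e₂ s) (-C.e₁ s) θ +
        C.radius s • rot (deriv C.e₂ s) (-deriv C.e₁ s) θ) s := by
  have hI := C.interval.1
  rw [funext fun t => dθ_X t θ]
  have d1 := hasDerivAt_of_smooth C.e₁_smooth hI hs
  have d2 := hasDerivAt_of_smooth C.e₂_smooth hI hs
  have dr := hasDerivAt_of_smooth C.radius_smooth hI hs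
  exact (dr.smul (hasDerivAt_rot d2 d1.neg θ)).congr_deriv (add_comm _ _)

theorem hasDerivAt_dθ_θ (s θ : ℝ) :
    HasDerivAt (fun t => dθ C.X s t) (-(C.radius s • rot (C.e₁ s) (C.e₂ s) θ)) θ := by
  rw [funext fun t => dθ_X s t]
  exact ((hasDerivAt_rot_angle _ _ θ).const_smul (C.radius s)).congr_deriv (by rw [rot_neg, smul_neg])

theorem anisotropicMeanCurvature_eq_zero_iff (hs : s ∈ C.I) {θ : ℝ}
    (h : unitNormal C.X s θ 2 ≠ 0) :
    anisotropicMeanCurvature dirichletIntegrand C.X s θ = 0 ↔ C.laplacian s θ = 0 := by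
  rw [DirichletCyclic.anisotropicMeanCurvature_eq_zero_iff (hasDerivAt_ds_s hs θ)
    (hasDerivAt_ds_θ hs θ) (hasDerivAt_dθ_s hs θ) (hasDerivAt_dθ_θ s θ) h, ds_X hs, dθ_X]
  rfl

theorem unitNormal_two_ne_zero_iff (hs : s ∈ C.I) {θ : ℝ} :
    unitNormal C.X s θ 2 ≠ 0 ↔
      cross (tangentS (deriv C.center s) (C.e₁ s) (C.e₂ s) (deriv C.e₁ s) (deriv C.e₂ s)
      (C.radius s) (deriv C.radius s) θ) (tangentθ (C.e₁ s) (C.e₂ s) (C.radius s) θ) 2 ≠ 0 := by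
  rw [unitNormal, ds_X hs, dθ_X, PiLp.smul_apply, smul_eq_mul]
  constructor
  · exact fun h h' => h (by rw [h', mul_zero])
  · intro h
    refine mul_ne_zero (inv_ne_zero (norm_ne_zero_iff.2 fun h' => h ?_)) h
    rw [h']; rfl

/-- Minimality only speaks of parameters with ν₃ ≠ 0. These are dense and `laplacian` is continuous
in (s, θ), so the equation extends to every θ, which the comparison of Fourier coefficients needs.
-/
theorem laplacian_eq_zero (hC : C.IsAnisotropicMinimal) (hs : s ∈ C.I) (θ : ℝ) :
    C.laplacian s θ = 0 := by
  have hI := C.interval.1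
  have hcont : ContinuousAt (fun q : ℝ × ℝ => C.laplacian q.1 q.2) (s, θ) := by
    have hq : ((s, θ) : ℝ × ℝ).1 ∈ C.I := hs
    have d1 := continuousAt_fst_of_smooth C.e₁_smooth hI hq
    have d2 := continuousAt_fst_of_smooth C.e₂_smooth hI hq
    have d1' := continuousAt_fst_of_smooth (smooth_deriv C.e₁_smooth hI) hI hq
    have d2' := continuousAt_fst_of_smooth (smooth_deriv C.e₂_smooth hI) hI hq
    have d1'' := continuousAt_fst_of_smooth (smooth_deriv (smooth_deriv C.e₁_smooth hI) hI) hI hq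
    have d2'' := continuousAt_fst_of_smooth (smooth_deriv (smooth_deriv C.e₂_smooth hI) hI) hI hq
    have dr := continuousAt_fst_of_smooth C.radius_smooth hI hq
    have dr' := continuousAt_fst_of_smooth (smooth_deriv C.radius_smooth hI) hI hq
    have dr'' := continuousAt_fst_of_smooth (smooth_deriv (smooth_deriv C.radius_smooth hI) hI) hI hq
    have dc' := continuousAt_fst_of_smooth (smooth_deriv C.center_smooth hI) hI hq
    have dc'' := continuousAt_fst_of_smooth (smooth_deriv (smooth_deriv C.center_smooth hI) hI) hI hq
    have key : ∀ A B P Q R : ℝ × ℝ → E3, ContinuousAt A (s, θ) → ContinuousAt B (s, θ) →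
        ContinuousAt P (s, θ) → ContinuousAt Q (s, θ) → ContinuousAt R (s, θ) →
        ContinuousAt (fun q => heightLaplacian (A q) (B q) (P q) (Q q) (Q q) (R q)) (s, θ) := by
      intro A B P Q R hA hB hP hQ hR
      simp only [heightLaplacian, horizontalInner, inner_coord, cross_zero, cross_one, cross_two]
      fun_prop
    apply key
    · unfold tangentS rot; fun_prop
    · unfold tangentθ rot; fun_prop
    · unfold rot; fun_prop
    · unfold rot; fun_prop
    · unfold rot; fun_prop
  by_contra hne
  have hev := hcont.eventually_ne hne
  have hmem : (s, θ) ∈ closure C.regular := hC.1 ⟨hs, trivial⟩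
  obtain ⟨q, hq, hq'⟩ := ((mem_closure_iff_frequently.1 hmem).and_eventually hev).exists
  exact hq' ((anisotropicMeanCurvature_eq_zero_iff hq.1 hq.2).1 (hC.2 q hq))

end CyclicSurface

/-! ### The top Fourier coefficient and the rotation of the planes. -/

/-- The `3 × 3` determinant of complex vectors. -/
noncomputable def cdet (a b c : Fin 3 → ℂ) : ℂ :=
  (a 1 * b 2 - a 2 * b 1) * c 0 + (a 2 * b 0 - a 0 * b 2) * c 1 + (a 0 * b 1 - a 1 * b 0) * c 2

/-- The isotropic vector `u - i v`. -/
noncomputable def isotropic (u v : E3) (i : Fin 3) : ℂ := u i - v i * Complex.I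

theorem hasLead_inner_cross {A B P : ℝ → E3} {a b p : Fin 3 → ℂ}
    (hA : ∀ i, HasLead 1 (fun θ => A θ i) (a i)) (hB : ∀ i, HasLead 1 (fun θ => B θ i) (b i))
    (hP : ∀ i, HasLead 1 (fun θ => P θ i) (p i)) :
    HasLead 3 (fun θ => ⟪cross (A θ) (B θ), P θ⟫) (cdet a b p) := by
  simp only [inner_coord, cross_zero, cross_one, cross_two]
  have h := fun i j k => (((hA i).mul (hB j)).sub ((hA j).mul (hB i))).mul (hP k)
  exact ((h 1 2 0).add (h 2 0 1)).add (h 0 1 2)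

theorem hasLead_horizontalInner {A B : ℝ → E3} {a b : Fin 3 → ℂ}
    (hA : ∀ i, HasLead 1 (fun θ => A θ i) (a i)) (hB : ∀ i, HasLead 1 (fun θ => B θ i) (b i)) :
    HasLead 2 (fun θ => horizontalInner (A θ) (B θ)) (a 0 * b 0 + a 1 * b 1) :=
  ((hA 0).mul (hB 0)).add ((hA 1).mul (hB 1))

/-- Write m, f, g for the isotropic vectors of the frame and its first two derivatives. The
coefficients of e^{iθ} are (r₁ m + r f)/2 in X_s and i r m/2 in X_θ, so in the determinants every
further multiple of m is absorbed and only det(f, m, g) survives. -/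
theorem hasLead_circleLaplacian (c₁ c₂ e₁ e₂ f₁ f₂ g₁ g₂ : E3) (r r₁ r₂ : ℝ) :
    HasLead 5 (circleLaplacian c₁ c₂ e₁ e₂ f₁ f₂ g₁ g₂ r r₁ r₂)
      (-(r : ℂ) ^ 5 * Complex.I / 32 * ((isotropic e₁ e₂ 0 ^ 2 + isotropic e₁ e₂ 1 ^ 2) *
        cdet (isotropic f₁ f₂) (isotropic e₁ e₂) (isotropic g₁ g₂))) := by
  have hA : ∀ i, HasLead 1 (fun θ => tangentS c₁ e₁ e₂ f₁ f₂ r r₁ θ i)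
      ((r₁ * isotropic e₁ e₂ i + r * isotropic f₁ f₂ i) / 2) := fun i =>
    (HasLead.linear (c₁ i) (r₁ * e₁ i + r * f₁ i) (r₁ * e₂ i + r * f₂ i)).congr
      (fun θ => by simp [tangentS, rot_apply]; ring) (by simp [isotropic]; ring)
  have hB : ∀ i, HasLead 1 (fun θ => tangentθ e₁ e₂ r θ i)
      (r * isotropic e₁ e₂ i * Complex.I / 2) := fun i =>
    (HasLead.linear 0 (r * e₂ i) (-(r * e₁ i))).congr
      (fun θ => by simp [tangentθ, rot_apply]; ring)
      (by simp [isotropic]; linear_combination (r * e₂ i : ℂ) * Complex.I_sq)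
  have hP : ∀ i, HasLead 1 (fun θ => (c₂ + ((r₂ • rot e₁ e₂ θ + (2 * r₁) • rot f₁ f₂ θ)
      + r • rot g₁ g₂ θ)) i)
      ((r₂ * isotropic e₁ e₂ i + 2 * r₁ * isotropic f₁ f₂ i + r * isotropic g₁ g₂ i) / 2) :=
    fun i => (HasLead.linear (c₂ i) (r₂ * e₁ i + 2 * r₁ * f₁ i + r * g₁ i)
      (r₂ * e₂ i + 2 * r₁ * f₂ i + r * g₂ i)).congr
      (fun θ => by simp [rot_apply]; ring) (by simp [isotropic]; ring)
  have hQ : ∀ i, HasLead 1 (fun θ => (r₁ • rot e₂ (-e₁) θ + r • rot f₂ (-f₁) θ) i)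
      ((r₁ * isotropic e₁ e₂ i + r * isotropic f₁ f₂ i) * Complex.I / 2) := fun i =>
    (HasLead.linear 0 (r₁ * e₂ i + r * f₂ i) (-(r₁ * e₁ i + r * f₁ i))).congr
      (fun θ => by simp [rot_apply]; ring)
      (by simp [isotropic]
          linear_combination (r₁ * e₂ i + r * f₂ i : ℂ) * Complex.I_sq)
  have hR : ∀ i, HasLead 1 (fun θ => (-(r • rot e₁ e₂ θ)) i) (-(r * isotropic e₁ e₂ i) / 2) :=
    fun i => (HasLead.linear 0 (-(r * e₁ i)) (-(r * e₂ i))).congr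
      (fun θ => by simp [rot_apply]; ring) (by simp [isotropic]; ring)
  have h1 := (hasLead_horizontalInner hB hB).mul (hasLead_inner_cross hA hB hP)
  have h2 := (hasLead_horizontalInner hA hB).mul
    ((hasLead_inner_cross hA hB hQ).add (hasLead_inner_cross hA hB hQ))
  have h3 := (hasLead_horizontalInner hA hA).mul (hasLead_inner_cross hA hB hR)
  refine ((h1.sub h2).add h3).congr (fun θ => rfl) ?_
  simp only [cdet]
  generalize isotropic e₁ e₂ 0 = m0
  generalize isotropic e₁ e₂ 1 = m1
  generalize isotropic e₁ e₂ 2 = m2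
  generalize isotropic f₁ f₂ 0 = u0
  generalize isotropic f₁ f₂ 1 = u1
  generalize isotropic f₁ f₂ 2 = u2
  generalize isotropic g₁ g₂ 0 = v0
  generalize isotropic g₁ g₂ 1 = v1
  generalize isotropic g₁ g₂ 2 = v2
  linear_combination ((r : ℂ) ^ 5 * Complex.I / 32 * (m0 ^ 2 + m1 ^ 2) *
    ((u1 * m2 - u2 * m1) * v0 + (u2 * m0 - u0 * m2) * v1 + (u0 * m1 - u1 * m0) * v2)) *
    Complex.I_sq

section Frame

variable {e₁ e₂ : E3}

theorem cross_frame (h₁ : ⟪e₁, e₁⟫ = 1) (h₂ : ⟪e₂, e₂⟫ = 1) (h₁₂ : ⟪e₁, e₂⟫ = 0) :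
    cross e₂ (cross e₁ e₂) = e₁ ∧ cross (cross e₁ e₂) e₁ = e₂ ∧
    ‖cross e₁ e₂‖ ^ 2 = 1 := by
  simp only [inner_coord] at h₁ h₂ h₁₂
  refine ⟨E3.ext' ?_ ?_ ?_, E3.ext' ?_ ?_ ?_, ?_⟩ <;>
    simp only [norm_sq_coord, cross_zero, cross_one, cross_two]
  · linear_combination e₁ 0 * h₂ - e₂ 0 * h₁₂
  · linear_combination e₁ 1 * h₂ - e₂ 1 * h₁₂
  · linear_combination e₁ 2 * h₂ - e₂ 2 * h₁₂
  · linear_combination e₂ 0 * h₁ - e₁ 0 * h₁₂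
  · linear_combination e₂ 1 * h₁ - e₁ 1 * h₁₂
  · linear_combination e₂ 2 * h₁ - e₁ 2 * h₁₂
  · linear_combination (e₂ 0 ^ 2 + e₂ 1 ^ 2 + e₂ 2 ^ 2) * h₁ + h₂ -
      (e₁ 0 * e₂ 0 + e₁ 1 * e₂ 1 + e₁ 2 * e₂ 2) * h₁₂

theorem frame_decomp (h₁ : ⟪e₁, e₁⟫ = 1) (h₂ : ⟪e₂, e₂⟫ = 1) (h₁₂ : ⟪e₁, e₂⟫ = 0)
    (w : E3) :
    w = ⟪w, e₁⟫ • e₁ + ⟪w, e₂⟫ • e₂ + ⟪w, cross e₁ e₂⟫ • cross e₁ e₂ := by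
  obtain ⟨a, b, c⟩ := cross_frame h₁ h₂ h₁₂
  have := norm_sq_smul_eq_dual w e₁ e₂
  rwa [a, b, c, one_smul] at this

/-- The vertical coordinates of an orthonormal basis are the coordinates of the unit vertical vector
in that basis. -/
theorem normal_vertical_sq (h₁ : ⟪e₁, e₁⟫ = 1) (h₂ : ⟪e₂, e₂⟫ = 1) (h₁₂ : ⟪e₁, e₂⟫ = 0) :
    (cross e₁ e₂ 2) ^ 2 + e₁ 2 ^ 2 + e₂ 2 ^ 2 = 1 := by
  have := congrArg (fun u : E3 => u 2) (frame_decomp h₁ h₂ h₁₂ !₂[0, 0, 1])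
  simp only [inner_coord, PiLp.add_apply, PiLp.smul_apply, smul_eq_mul] at this
  simp at this
  simp only [cross_two]
  linear_combination -this

/-- The coefficient of the Laplacian of highest degree vanishes only for parallel planes. -/
theorem twist_eq_zero (h₁ : ⟪e₁, e₁⟫ = 1) (h₂ : ⟪e₂, e₂⟫ = 1) (h₁₂ : ⟪e₁, e₂⟫ = 0)
    {f₁ f₂ g₁ g₂ : E3} (k₁ : ⟪f₁, e₁⟫ = 0) (k₂ : ⟪f₂, e₂⟫ = 0)
    (k₁₂ : ⟪f₁, e₂⟫ + ⟪f₂, e₁⟫ = 0) (l₁ : ⟪g₁, e₁⟫ + ⟪f₁, f₁⟫ = 0)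
    (l₂ : ⟪g₂, e₂⟫ + ⟪f₂, f₂⟫ = 0) (l₁₂ : ⟪g₁, e₂⟫ + 2 * ⟪f₁, f₂⟫ + ⟪g₂, e₁⟫ = 0)
    (h : cdet (isotropic f₁ f₂) (isotropic e₁ e₂) (isotropic g₁ g₂) = 0) :
    ⟪f₁, cross e₁ e₂⟫ = 0 ∧ ⟪f₂, cross e₁ e₂⟫ = 0 := by
  obtain ⟨ha, hb, hc⟩ := cross_frame h₁ h₂ h₁₂
  have d₁ := frame_decomp h₁ h₂ h₁₂ f₁
  have d₂ := frame_decomp h₁ h₂ h₁₂ f₂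
  have hn₁ : ⟪e₁, cross e₁ e₂⟫ = 0 := by simp [inner_coord]; ring
  have hn₂ : ⟪e₂, cross e₁ e₂⟫ = 0 := by simp [inner_coord]; ring
  rw [k₁, zero_smul, zero_add] at d₁
  rw [k₂, zero_smul, add_zero, eq_neg_of_add_eq_zero_right k₁₂] at d₂
  rw [norm_sq_coord] at hc
  have hnn : ⟪cross e₁ e₂, cross e₁ e₂⟫ = 1 := by rw [inner_coord, ← hc]; ring
  generalize ⟪f₁, e₂⟫ = w₀ at *
  generalize ⟪f₁, cross e₁ e₂⟫ = p at *
  generalize ⟪f₂, cross e₁ e₂⟫ = q at *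
  generalize cross e₁ e₂ = n at *
  have q₁ : ⟪f₁, f₁⟫ = w₀ ^ 2 + p ^ 2 := by
    rw [d₁]; simp only [inner_add_left, inner_add_right, real_inner_smul_left,
      real_inner_smul_right, real_inner_comm e₂ n, hn₂, h₂, hnn]; ring
  have q₂ : ⟪f₂, f₂⟫ = w₀ ^ 2 + q ^ 2 := by
    rw [d₂]; simp only [inner_add_left, inner_add_right, real_inner_smul_left,
      real_inner_smul_right, real_inner_comm e₁ n, hn₁, h₁, hnn]; ring
  have q₁₂ : ⟪f₁, f₂⟫ = p * q := by
    rw [d₁, d₂]; simp only [inner_add_left, inner_add_right, real_inner_smul_left,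
      real_inner_smul_right, real_inner_comm e₁ n, real_inner_comm e₁ e₂, hn₁, hn₂, h₁₂, hnn]
    ring
  -- With m = e₁ - i e₂, p = ⟨f₁, n⟩ and q = ⟨f₂, n⟩, the derivative of m is i w₀ m + (p - iq) n,
  -- and n × m = i m. So its cross product with m is i (p - iq) m, and the determinant reduces to
  -- the product of m with its second derivative.
  have hm : cdet (isotropic f₁ f₂) (isotropic e₁ e₂) (isotropic g₁ g₂) =
      Complex.I * (p - q * Complex.I) * (isotropic e₁ e₂ 0 * isotropic g₁ g₂ 0 +
        isotropic e₁ e₂ 1 * isotropic g₁ g₂ 1 + isotropic e₁ e₂ 2 * isotropic g₁ g₂ 2) := by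
    have c₁ : ∀ i, (f₁ i : ℂ) = w₀ * e₂ i + p * n i := fun i => by
      have := congrArg (fun u : E3 => (u i : ℂ)) d₁
      simpa using this
    have c₂ : ∀ i, (f₂ i : ℂ) = -w₀ * e₁ i + q * n i := fun i => by
      have := congrArg (fun u : E3 => (u i : ℂ)) d₂
      simpa using this
    have a0 : ((e₂ 1 * n 2 - e₂ 2 * n 1 : ℝ) : ℂ) = e₁ 0 := congrArg (fun u : E3 => (u 0 : ℂ)) ha
    have a1 : ((e₂ 2 * n 0 - e₂ 0 * n 2 : ℝ) : ℂ) = e₁ 1 := congrArg (fun u : E3 => (u 1 : ℂ)) ha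
    have a2 : ((e₂ 0 * n 1 - e₂ 1 * n 0 : ℝ) : ℂ) = e₁ 2 := congrArg (fun u : E3 => (u 2 : ℂ)) ha
    have b0 : ((n 1 * e₁ 2 - n 2 * e₁ 1 : ℝ) : ℂ) = e₂ 0 := congrArg (fun u : E3 => (u 0 : ℂ)) hb
    have b1 : ((n 2 * e₁ 0 - n 0 * e₁ 2 : ℝ) : ℂ) = e₂ 1 := congrArg (fun u : E3 => (u 1 : ℂ)) hb
    have b2 : ((n 0 * e₁ 1 - n 1 * e₁ 0 : ℝ) : ℂ) = e₂ 2 := congrArg (fun u : E3 => (u 2 : ℂ)) hb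
    push_cast at a0 a1 a2 b0 b1 b2
    have hI := Complex.I_sq
    have x0 : isotropic f₁ f₂ 1 * isotropic e₁ e₂ 2 - isotropic f₁ f₂ 2 * isotropic e₁ e₂ 1 =
        Complex.I * (p - q * Complex.I) * isotropic e₁ e₂ 0 := by
      simp only [isotropic, c₁, c₂]
      linear_combination (p - q * Complex.I) * (b0 + Complex.I * a0 + e₂ 0 * hI)
        - w₀ * (e₁ 1 * e₂ 2 - e₁ 2 * e₂ 1) * hI
    have x1 : isotropic f₁ f₂ 2 * isotropic e₁ e₂ 0 - isotropic f₁ f₂ 0 * isotropic e₁ e₂ 2 =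
        Complex.I * (p - q * Complex.I) * isotropic e₁ e₂ 1 := by
      simp only [isotropic, c₁, c₂]
      linear_combination (p - q * Complex.I) * (b1 + Complex.I * a1 + e₂ 1 * hI)
        - w₀ * (e₁ 2 * e₂ 0 - e₁ 0 * e₂ 2) * hI
    have x2 : isotropic f₁ f₂ 0 * isotropic e₁ e₂ 1 - isotropic f₁ f₂ 1 * isotropic e₁ e₂ 0 =
        Complex.I * (p - q * Complex.I) * isotropic e₁ e₂ 2 := by
      simp only [isotropic, c₁, c₂]
      linear_combination (p - q * Complex.I) * (b2 + Complex.I * a2 + e₂ 2 * hI)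
        - w₀ * (e₁ 0 * e₂ 1 - e₁ 1 * e₂ 0) * hI
    rw [cdet, x0, x1, x2]; ring
  -- Differentiating m · m = 0 twice gives m · m'' = -m' · m', and m' · m' = (p - iq)² because m · m
  -- = m · n = 0. The determinant is therefore -i (p - iq)³.
  have hs : isotropic e₁ e₂ 0 * isotropic g₁ g₂ 0 + isotropic e₁ e₂ 1 * isotropic g₁ g₂ 1 +
      isotropic e₁ e₂ 2 * isotropic g₁ g₂ 2 = -(p - q * Complex.I) ^ 2 := by
    rw [q₁] at l₁
    rw [q₂] at l₂
    rw [q₁₂] at l₁₂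
    simp only [inner_coord] at l₁ l₂ l₁₂
    have l₁' := congrArg (fun x : ℝ => (x : ℂ)) l₁
    have l₂' := congrArg (fun x : ℝ => (x : ℂ)) l₂
    have l₁₂' := congrArg (fun x : ℝ => (x : ℂ)) l₁₂
    push_cast at l₁' l₂' l₁₂'
    simp only [isotropic]
    linear_combination l₁' - l₂' - Complex.I * l₁₂' +
      (e₂ 0 * g₂ 0 + e₂ 1 * g₂ 1 + e₂ 2 * g₂ 2 + (q : ℂ) ^ 2) * Complex.I_sq
  rw [hm, hs] at h
  have hp : ((p : ℂ) - q * Complex.I) = 0 := by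
    by_contra hne
    simp [hne] at h
  have hre := congrArg Complex.re hp
  have him := congrArg Complex.im hp
  simp at hre him
  exact ⟨hre, him⟩

/-- Orthonormality of e₁, e₂ makes m = e₁ - i e₂ isotropic, m · m = 0. Thus the factor m₀² + m₁² in
the top coefficient vanishes exactly when the plane is horizontal. -/
theorem isotropic_horizontal_sq (h₁ : ⟪e₁, e₁⟫ = 1) (h₂ : ⟪e₂, e₂⟫ = 1) (h₁₂ : ⟪e₁, e₂⟫ = 0) :
    isotropic e₁ e₂ 0 ^ 2 + isotropic e₁ e₂ 1 ^ 2 = -isotropic e₁ e₂ 2 ^ 2 := by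
  simp only [inner_coord] at h₁ h₂ h₁₂
  have h₁' := congrArg (fun x : ℝ => (x : ℂ)) h₁
  have h₂' := congrArg (fun x : ℝ => (x : ℂ)) h₂
  have h₁₂' := congrArg (fun x : ℝ => (x : ℂ)) h₁₂
  push_cast at h₁' h₂' h₁₂'
  simp only [isotropic]
  linear_combination h₁' - h₂' - 2 * Complex.I * h₁₂' +
    (e₂ 0 * e₂ 0 + e₂ 1 * e₂ 1 + e₂ 2 * e₂ 2 : ℂ) * Complex.I_sq

end Frame

theorem isotropic_eq_zero {u v : E3} {i : Fin 3} (h : isotropic u v i = 0) : u i = 0 ∧ v i = 0 := by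
  have hre := congrArg Complex.re h
  have him := congrArg Complex.im h
  simp [isotropic] at hre him
  exact ⟨hre, him⟩

theorem IsOpenInterval.eq_of_hasDerivAt_zero {F : Type*} [NormedAddCommGroup F] [NormedSpace ℝ F]
    {I : Set ℝ} (hI : IsOpenInterval I) {f : ℝ → F} (h : ∀ s ∈ I, HasDerivAt f 0 s) {s t : ℝ}
    (hs : s ∈ I) (ht : t ∈ I) : f s = f t :=
  hI.1.is_const_of_deriv_eq_zero hI.2.1.isPreconnected
    (fun x hx => (h x hx).differentiableAt.differentiableWithinAt) (fun x hx => (h x hx).deriv)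
    hs ht

/-! ### Circles in parallel planes. -/

theorem inner_cross_cross (a b c d : E3) :
    ⟪cross a b, cross c d⟫ = ⟪a, c⟫ * ⟪b, d⟫ - ⟪a, d⟫ * ⟪b, c⟫ := by
  simp only [inner_coord, cross_zero, cross_one, cross_two]; ring

theorem horizontalInner_self_nonneg (u : E3) : 0 ≤ horizontalInner u u := by
  unfold horizontalInner; nlinarith [sq_nonneg (u 0), sq_nonneg (u 1)]

theorem horizontalInner_self_eq_zero {u : E3} (h : horizontalInner u u = 0) :
    u 0 = 0 ∧ u 1 = 0 := by
  unfold horizontalInner at h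
  constructor <;> nlinarith [sq_nonneg (u 0), sq_nonneg (u 1)]

/-- `circleLaplacian / r²` for circles in parallel planes. -/
noncomputable def parallelLaplacian (c₁ c₂ e₁ e₂ : E3) (r r₁ r₂ θ : ℝ) : ℝ :=
  r * horizontalInner (rot e₂ (-e₁) θ) (rot e₂ (-e₁) θ) *
      (⟪cross e₁ e₂, c₂⟫ * (⟪c₁, rot e₁ e₂ θ⟫ + r₁) -
        ⟪cross e₁ e₂, c₁⟫ * (⟪c₂, rot e₁ e₂ θ⟫ + r₂)) +
    ⟪cross e₁ e₂, c₁⟫ * horizontalInner (c₁ + r₁ • rot e₁ e₂ θ) (c₁ + r₁ • rot e₁ e₂ θ)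

section Frame

variable {e₁ e₂ : E3}

theorem inner_rot_rot (h₁ : ⟪e₁, e₁⟫ = 1) (h₂ : ⟪e₂, e₂⟫ = 1) (h₁₂ : ⟪e₁, e₂⟫ = 0) (θ : ℝ) :
    ⟪rot e₁ e₂ θ, rot e₁ e₂ θ⟫ = 1 ∧ ⟪rot e₂ (-e₁) θ, rot e₂ (-e₁) θ⟫ = 1 ∧
    ⟪rot e₁ e₂ θ, rot e₂ (-e₁) θ⟫ = 0 ∧ cross (rot e₁ e₂ θ) (rot e₂ (-e₁) θ) = cross e₁ e₂ := by
  have hc := Real.sin_sq_add_cos_sq θ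
  have h₂₁ : ⟪e₂, e₁⟫ = 0 := by rw [real_inner_comm, h₁₂]
  refine ⟨?_, ?_, ?_, ?_⟩
  · simp only [rot, inner_add_left, inner_add_right, real_inner_smul_left, real_inner_smul_right,
      h₁, h₂, h₁₂, h₂₁]
    linear_combination hc
  · simp only [rot, inner_add_left, inner_add_right, real_inner_smul_left, real_inner_smul_right,
      inner_neg_left, inner_neg_right, h₁, h₂, h₁₂, h₂₁]
    linear_combination hc
  · simp only [rot, inner_add_left, inner_add_right, real_inner_smul_left, real_inner_smul_right,
      inner_neg_right, h₁, h₂, h₁₂, h₂₁]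
    ring
  · apply E3.ext' <;> simp only [cross_zero, cross_one, cross_two, rot_apply, PiLp.neg_apply]
    · linear_combination (e₁ 1 * e₂ 2 - e₁ 2 * e₂ 1) * hc
    · linear_combination (e₁ 2 * e₂ 0 - e₁ 0 * e₂ 2) * hc
    · linear_combination (e₁ 0 * e₂ 1 - e₁ 1 * e₂ 0) * hc

theorem cross_eq_of_frame (h₁ : ⟪e₁, e₁⟫ = 1) (h₂ : ⟪e₂, e₂⟫ = 1) (h₁₂ : ⟪e₁, e₂⟫ = 0) (d : E3) :
    cross d e₂ = ⟪d, e₁⟫ • cross e₁ e₂ - ⟪cross e₁ e₂, d⟫ • e₁ := by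
  have h := frame_decomp h₁ h₂ h₁₂ (cross d e₂)
  have a : ⟪cross d e₂, e₁⟫ = -⟪cross e₁ e₂, d⟫ := by
    simp only [inner_coord, cross_zero, cross_one, cross_two]; ring
  have b : ⟪cross d e₂, e₂⟫ = 0 := by
    simp only [inner_coord, cross_zero, cross_one, cross_two]; ring
  have h₂₁ : ⟪e₂, e₁⟫ = 0 := by rw [real_inner_comm, h₁₂]
  rw [a, b, inner_cross_cross, h₂, h₂₁] at h
  rw [h]; module

theorem cross_eq_smul_normal (h₁ : ⟪e₁, e₁⟫ = 1) (h₂ : ⟪e₂, e₂⟫ = 1) (h₁₂ : ⟪e₁, e₂⟫ = 0)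
    {a b : E3} (ha : ⟪a, cross e₁ e₂⟫ = 0) (hb : ⟪b, cross e₁ e₂⟫ = 0) :
    cross a b = ⟪cross a b, cross e₁ e₂⟫ • cross e₁ e₂ := by
  obtain ⟨x, y, -⟩ := cross_frame h₁ h₂ h₁₂
  have u : ⟪cross a b, e₁⟫ = 0 := by
    rw [← x, inner_cross_cross, ha, hb]; ring
  have v : ⟪cross a b, e₂⟫ = 0 := by
    rw [← y, inner_cross_cross, ha, hb]; ring
  have h := frame_decomp h₁ h₂ h₁₂ (cross a b)
  rw [u, v] at h
  simpa using h

/-- Here the frame rotates within its fixed plane with angular velocity w, and k plays the role of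
w'. Such a rotation only reparametrizes each circle, so w and k disappear from the equation. -/
theorem circleLaplacian_of_parallel (h₁ : ⟪e₁, e₁⟫ = 1) (h₂ : ⟪e₂, e₂⟫ = 1) (h₁₂ : ⟪e₁, e₂⟫ = 0)
    (c₁ c₂ : E3) (r r₁ r₂ w k θ : ℝ) :
    circleLaplacian c₁ c₂ e₁ e₂ (w • e₂) (-(w • e₁)) (-w ^ 2 • e₁ + k • e₂)
      (-(k • e₁) - w ^ 2 • e₂) r r₁ r₂ θ = r ^ 2 * parallelLaplacian c₁ c₂ e₁ e₂ r r₁ r₂ θ := by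
  obtain ⟨hE, hT, hET, hn⟩ := inner_rot_rot h₁ h₂ h₁₂ θ
  have hD := cross_eq_of_frame hE hT hET (c₁ + r₁ • rot e₁ e₂ θ)
  have a1 : rot (w • e₂) (-(w • e₁)) θ = w • rot e₂ (-e₁) θ := by simp only [rot]; module
  have a2 : rot (-w ^ 2 • e₁ + k • e₂) (-(k • e₁) - w ^ 2 • e₂) θ =
      -w ^ 2 • rot e₁ e₂ θ + k • rot e₂ (-e₁) θ := by simp only [rot]; module
  have a3 : rot (-(w • e₁)) (-(w • e₂)) θ = -w • rot e₁ e₂ θ := by simp only [rot]; module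
  rw [circleLaplacian, tangentS, tangentθ, parallelLaplacian, a1, a2, a3, ← hn]
  generalize rot e₁ e₂ θ = E at *
  generalize rot e₂ (-e₁) θ = T at *
  have hN : cross (c₁ + (r₁ • E + r • w • T)) (r • T) = r • cross (c₁ + r₁ • E) T := by
    apply E3.ext' <;> simp <;> ring
  have i1 : ⟪c₁ + r₁ • E, E⟫ = ⟪c₁, E⟫ + r₁ := by
    rw [inner_add_left, real_inner_smul_left, hE, mul_one]
  have i2 : ⟪cross E T, c₁ + r₁ • E⟫ = ⟪cross E T, c₁⟫ := by
    simp [inner_coord]; ring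
  rw [i1, i2] at hD
  have z1 : ⟪cross E T, E⟫ = 0 := by simp [inner_coord]; ring
  have z2 : ⟪cross E T, T⟫ = 0 := by simp [inner_coord]; ring
  have p1 : ⟪cross (c₁ + r₁ • E) T, c₂ + ((r₂ • E + (2 * r₁) • w • T) +
      r • (-w ^ 2 • E + k • T))⟫ = (⟪c₁, E⟫ + r₁) * ⟪cross E T, c₂⟫ -
        ⟪cross E T, c₁⟫ * (⟪c₂, E⟫ + r₂ - r * w ^ 2) := by
    rw [hD]
    simp only [inner_sub_left, inner_add_right, real_inner_smul_left, real_inner_smul_right,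
      z1, z2, hE, hET, real_inner_comm c₂ E]
    ring
  have p2 : ⟪cross (c₁ + r₁ • E) T, r₁ • T + r • -w • E⟫ = r * w * ⟪cross E T, c₁⟫ := by
    rw [hD]
    simp only [inner_sub_left, inner_add_right, real_inner_smul_left, real_inner_smul_right,
      z1, z2, hE, hET]
    ring
  have p3 : ⟪cross (c₁ + r₁ • E) T, -(r • E)⟫ = r * ⟪cross E T, c₁⟫ := by
    rw [hD]
    simp only [inner_sub_left, inner_neg_right, real_inner_smul_left, real_inner_smul_right,
      z1, hE]
    ring
  rw [heightLaplacian, hN, real_inner_smul_left, real_inner_smul_left, real_inner_smul_left,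
    p1, p2, p3]
  generalize ⟪cross E T, c₁⟫ = x
  generalize ⟪cross E T, c₂⟫ = y
  generalize ⟪c₁, E⟫ = z
  generalize ⟪c₂, E⟫ = t
  simp only [horizontalInner, PiLp.add_apply, PiLp.smul_apply, smul_eq_mul]
  ring

/-- For circles in parallel planes that are not horizontal, the equation forces a vertical
translation, unless the planes coincide. -/
theorem vertical_translation_of_parallelLaplacian (h₁ : ⟪e₁, e₁⟫ = 1) (h₂ : ⟪e₂, e₂⟫ = 1)
    (h₁₂ : ⟪e₁, e₂⟫ = 0) {c₁ c₂ : E3} {r r₁ r₂ : ℝ} (hr : r ≠ 0)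
    (hz : isotropic e₁ e₂ 2 ≠ 0) (hk : ⟪cross e₁ e₂, c₁⟫ ≠ 0)
    (h : ∀ θ, parallelLaplacian c₁ c₂ e₁ e₂ r r₁ r₂ θ = 0) :
    r₁ = 0 ∧ c₁ 0 = 0 ∧ c₁ 1 = 0 := by
  have hm := isotropic_horizontal_sq h₁ h₂ h₁₂
  unfold parallelLaplacian at h
  generalize ⟪cross e₁ e₂, c₁⟫ = k at *
  generalize ⟪cross e₁ e₂, c₂⟫ = y at *
  have hT : ∀ i, HasLead 1 (fun θ => rot e₂ (-e₁) θ i)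
      (isotropic e₁ e₂ i * Complex.I / 2) := fun i =>
    (HasLead.linear 0 (e₂ i) (-(e₁ i))).congr
      (fun θ => by simp [rot_apply])
      (by simp [isotropic]; linear_combination (e₂ i : ℂ) * Complex.I_sq)
  have hD : ∀ i, HasLead 1 (fun θ => (c₁ + r₁ • rot e₁ e₂ θ) i)
      (r₁ * isotropic e₁ e₂ i / 2) := fun i =>
    (HasLead.linear (c₁ i) (r₁ * e₁ i) (r₁ * e₂ i)).congr
      (fun θ => by simp [rot_apply]; ring) (by simp [isotropic]; ring)
  have hTT := (hasLead_horizontalInner hT hT).congr (fun θ => rfl)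
    (M := isotropic e₁ e₂ 2 ^ 2 / 4)
    (by linear_combination (-1 / 4) * hm +
          (isotropic e₁ e₂ 0 ^ 2 + isotropic e₁ e₂ 1 ^ 2) / 4 * Complex.I_sq)
  have hDD := (hasLead_horizontalInner hD hD).congr (fun θ => rfl)
    (M := -r₁ ^ 2 * isotropic e₁ e₂ 2 ^ 2 / 4) (by linear_combination (r₁ ^ 2 / 4 : ℂ) * hm)
  have hin : ∀ (c : E3) θ, ⟪c, rot e₁ e₂ θ⟫ = ⟪c, e₁⟫ * Real.cos θ + ⟪c, e₂⟫ * Real.sin θ := by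
    intro c θ
    simp only [rot, inner_add_right, real_inner_smul_right]; ring
  have hK := HasLead.linear (y * r₁ - k * r₂) (y * ⟪c₁, e₁⟫ - k * ⟪c₂, e₁⟫)
    (y * ⟪c₁, e₂⟫ - k * ⟪c₂, e₂⟫)
  -- Degree 3 comes only from the first summand. Since the lead of |T|² (horizontal part) is nonzero
  -- for a plane that is not horizontal, the θ-dependent part of the other factor must vanish.
  have e3 := ((((HasLead.const r).mul hTT).mul hK).add ((HasLead.const k).mul hDD).raise).eq_zero
    (fun θ => by
      have := h θ
      rw [hin, hin] at this
      rw [← this]; ring)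
  have hlin : isotropic e₁ e₂ 2 ^ 2 / 4 ≠ 0 := by
    exact div_ne_zero (pow_ne_zero 2 hz) (by norm_num)
  have hrC : (r : ℂ) ≠ 0 := by exact_mod_cast hr
  have e3' : ((y * ⟪c₁, e₁⟫ - k * ⟪c₂, e₁⟫ : ℝ) : ℂ) -
      ((y * ⟪c₁, e₂⟫ - k * ⟪c₂, e₂⟫ : ℝ) : ℂ) * Complex.I = 0 := by
    rw [add_zero, mul_eq_zero, or_iff_right (mul_ne_zero hrC hlin)] at e3
    simpa using e3
  have hre := congrArg Complex.re e3'
  have him := congrArg Complex.im e3'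
  simp only [Complex.sub_re, Complex.sub_im, Complex.ofReal_re, Complex.ofReal_im,
    Complex.mul_re, Complex.mul_im, Complex.I_re, Complex.I_im, Complex.zero_re,
    Complex.zero_im] at hre him
  have hred : ∀ θ, r * (y * r₁ - k * r₂) *
      horizontalInner (rot e₂ (-e₁) θ) (rot e₂ (-e₁) θ) +
      k * horizontalInner (c₁ + r₁ • rot e₁ e₂ θ) (c₁ + r₁ • rot e₁ e₂ θ) = 0 := by
    intro θ
    have := h θ
    rw [hin, hin] at this
    linear_combination this - r * horizontalInner (rot e₂ (-e₁) θ) (rot e₂ (-e₁) θ) *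
      (Real.cos θ * hre - Real.sin θ * him)
  -- What remains has degree 2, and its lead fixes the constant factor as k r₁².
  have e2 := (((HasLead.const (r * (y * r₁ - k * r₂))).mul hTT).add
    ((HasLead.const k).mul hDD)).eq_zero hred
  have e2' : r * (y * r₁ - k * r₂) = k * r₁ ^ 2 := by
    have : (((r * (y * r₁ - k * r₂) : ℝ) : ℂ) - k * r₁ ^ 2) * (isotropic e₁ e₂ 2 ^ 2 / 4) = 0 := by
      rw [← e2]; ring
    rw [mul_eq_zero, or_iff_left hlin, sub_eq_zero] at this
    exact_mod_cast this
  -- After division by k ≠ 0 the equation is a sum of two nonnegative terms, so the horizontal part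
  -- of c₁ + r₁ E vanishes for every θ.
  have hzero : ∀ θ, horizontalInner (c₁ + r₁ • rot e₁ e₂ θ) (c₁ + r₁ • rot e₁ e₂ θ) = 0 := by
    intro θ
    have h' := hred θ
    rw [e2', mul_assoc, ← mul_add, mul_eq_zero, or_iff_right hk] at h'
    have := horizontalInner_self_nonneg (c₁ + r₁ • rot e₁ e₂ θ)
    have := mul_nonneg (sq_nonneg r₁) (horizontalInner_self_nonneg (rot e₂ (-e₁) θ))
    linarith
  have hcoord := fun θ => horizontalInner_self_eq_zero (hzero θ)
  simp only [PiLp.add_apply, PiLp.smul_apply, smul_eq_mul, rot_apply] at hcoord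
  obtain ⟨u0, u1⟩ := hcoord 0
  obtain ⟨v0, v1⟩ := hcoord Real.pi
  obtain ⟨w0, w1⟩ := hcoord (Real.pi / 2)
  simp at u0 u1 v0 v1 w0 w1
  have c0 : c₁ 0 = 0 := by linarith
  have c1 : c₁ 1 = 0 := by linarith
  refine ⟨?_, c0, c1⟩
  rw [c0, zero_add] at u0 w0
  rw [c1, zero_add] at u1 w1
  -- If r₁ ≠ 0, both e₁ and e₂ would be vertical, which is impossible for orthogonal unit vectors.
  by_contra hr₁
  have a0 := (mul_eq_zero.1 u0).resolve_left hr₁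
  have a1 := (mul_eq_zero.1 u1).resolve_left hr₁
  have b0 := (mul_eq_zero.1 w0).resolve_left hr₁
  have b1 := (mul_eq_zero.1 w1).resolve_left hr₁
  rw [inner_coord] at h₁ h₂ h₁₂
  rw [a0, a1] at h₁ h₁₂
  rw [b0, b1] at h₂
  have : (e₁ 2 * e₂ 2) ^ 2 = 1 := by
    linear_combination (e₂ 2) ^ 2 * h₁ + h₂
  have h0 : e₁ 2 * e₂ 2 = 0 := by linarith
  rw [h0] at this
  norm_num at this

end Frame

/-! ### Minimal cyclic surfaces: parallel planes, and the inclined case. -/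

namespace CyclicSurface

variable {C : CyclicSurface} {s : ℝ}

theorem inner_frame (hs : s ∈ C.I) :
    ⟪C.e₁ s, C.e₁ s⟫ = 1 ∧ ⟪C.e₂ s, C.e₂ s⟫ = 1 ∧ ⟪C.e₁ s, C.e₂ s⟫ = 0 := by
  have h := orthonormal_iff_ite.1 (C.orthonormal s hs)
  refine ⟨?_, ?_, ?_⟩
  · simpa using h 0 0
  · simpa using h 1 1
  · simpa using h 0 1

theorem hasDerivAt_of_eqOn_const {f : ℝ → ℝ} {f' a : ℝ} (hf : HasDerivAt f f' s) {I : Set ℝ}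
    (hI : IsOpen I) (hs : s ∈ I) (h : ∀ t ∈ I, f t = a) : f' = 0 := by
  refine hf.unique ((hasDerivAt_const s a).congr_of_eventuallyEq ?_)
  filter_upwards [hI.mem_nhds hs] with t ht using h t ht

theorem inner_frame_deriv (hs : s ∈ C.I) :
    ⟪deriv C.e₁ s, C.e₁ s⟫ = 0 ∧ ⟪deriv C.e₂ s, C.e₂ s⟫ = 0 ∧
      ⟪deriv C.e₁ s, C.e₂ s⟫ + ⟪deriv C.e₂ s, C.e₁ s⟫ = 0 := by
  have hI := C.interval.1
  have d1 := hasDerivAt_of_smooth C.e₁_smooth hI hs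
  have d2 := hasDerivAt_of_smooth C.e₂_smooth hI hs
  have a := hasDerivAt_of_eqOn_const (d1.inner ℝ d1) hI hs (fun t ht => (inner_frame ht).1)
  have b := hasDerivAt_of_eqOn_const (d2.inner ℝ d2) hI hs (fun t ht => (inner_frame ht).2.1)
  have c := hasDerivAt_of_eqOn_const (d1.inner ℝ d2) hI hs (fun t ht => (inner_frame ht).2.2)
  rw [real_inner_comm] at a b c
  exact ⟨by linarith, by linarith, by linarith⟩

theorem inner_frame_deriv_deriv (hs : s ∈ C.I) :
    ⟪deriv (deriv C.e₁) s, C.e₁ s⟫ + ⟪deriv C.e₁ s, deriv C.e₁ s⟫ = 0 ∧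
    ⟪deriv (deriv C.e₂) s, C.e₂ s⟫ + ⟪deriv C.e₂ s, deriv C.e₂ s⟫ = 0 ∧
    ⟪deriv (deriv C.e₁) s, C.e₂ s⟫ + 2 * ⟪deriv C.e₁ s, deriv C.e₂ s⟫ +
      ⟪deriv (deriv C.e₂) s, C.e₁ s⟫ = 0 := by
  have hI := C.interval.1
  have d1 := hasDerivAt_of_smooth C.e₁_smooth hI hs
  have d2 := hasDerivAt_of_smooth C.e₂_smooth hI hs
  have f1 := hasDerivAt_of_smooth (smooth_deriv C.e₁_smooth hI) hI hs
  have f2 := hasDerivAt_of_smooth (smooth_deriv C.e₂_smooth hI) hI hs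
  have a := hasDerivAt_of_eqOn_const (f1.inner ℝ d1) hI hs (fun t ht => (inner_frame_deriv ht).1)
  have b := hasDerivAt_of_eqOn_const (f2.inner ℝ d2) hI hs
    (fun t ht => (inner_frame_deriv ht).2.1)
  have c := hasDerivAt_of_eqOn_const ((f1.inner ℝ d2).add (f2.inner ℝ d1)) hI hs
    (fun t ht => (inner_frame_deriv ht).2.2)
  refine ⟨by linarith, by linarith, ?_⟩
  linarith [real_inner_comm (deriv C.e₁ s) (deriv C.e₂ s)]

variable (C) in
/-- The unit normal of the plane of the circle of parameter `s`. -/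
noncomputable def normal (s : ℝ) : E3 := cross (C.e₁ s) (C.e₂ s)

/-- The normal rotates with the angular velocities `⟪e₁', n⟫` and `⟪e₂', n⟫`. -/
theorem hasDerivAt_normal (hs : s ∈ C.I) :
    HasDerivAt C.normal (-(⟪deriv C.e₁ s, C.normal s⟫ • C.e₁ s +
      ⟪deriv C.e₂ s, C.normal s⟫ • C.e₂ s)) s := by
  have hI := C.interval.1
  refine (HasDerivAt.cross (hasDerivAt_of_smooth C.e₁_smooth hI hs)
    (hasDerivAt_of_smooth C.e₂_smooth hI hs)).congr_deriv ?_
  obtain ⟨h₁, h₂, h₁₂⟩ := inner_frame hs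
  obtain ⟨k₁, k₂, k₁₂⟩ := inner_frame_deriv hs
  have h₂₁ : ⟪C.e₂ s, C.e₁ s⟫ = 0 := by rw [real_inner_comm, h₁₂]
  rw [frame_decomp h₁ h₂ h₁₂ (cross (deriv C.e₁ s) (C.e₂ s) + cross (C.e₁ s) (deriv C.e₂ s)),
    normal]
  have a : ⟪cross (deriv C.e₁ s) (C.e₂ s) + cross (C.e₁ s) (deriv C.e₂ s), C.e₁ s⟫ =
      -⟪deriv C.e₁ s, cross (C.e₁ s) (C.e₂ s)⟫ := by
    simp only [inner_coord, cross_zero, cross_one, cross_two, PiLp.add_apply]; ring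
  have b : ⟪cross (deriv C.e₁ s) (C.e₂ s) + cross (C.e₁ s) (deriv C.e₂ s), C.e₂ s⟫ =
      -⟪deriv C.e₂ s, cross (C.e₁ s) (C.e₂ s)⟫ := by
    simp only [inner_coord, cross_zero, cross_one, cross_two, PiLp.add_apply]; ring
  have c : ⟪cross (deriv C.e₁ s) (C.e₂ s) + cross (C.e₁ s) (deriv C.e₂ s),
      cross (C.e₁ s) (C.e₂ s)⟫ = 0 := by
    rw [inner_add_left, inner_cross_cross, inner_cross_cross, h₁, h₂, h₁₂, h₂₁, k₁, k₂]; ring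
  rw [a, b, c]; module

theorem twist_eq_zero_of_not_horizontal (hC : C.IsAnisotropicMinimal) (hs : s ∈ C.I)
    (h : isotropic (C.e₁ s) (C.e₂ s) 2 ≠ 0) :
    ⟪deriv C.e₁ s, C.normal s⟫ = 0 ∧ ⟪deriv C.e₂ s, C.normal s⟫ = 0 := by
  obtain ⟨h₁, h₂, h₁₂⟩ := inner_frame hs
  obtain ⟨k₁, k₂, k₁₂⟩ := inner_frame_deriv hs
  obtain ⟨l₁, l₂, l₁₂⟩ := inner_frame_deriv_deriv hs
  have hl := (hasLead_circleLaplacian (deriv C.center s) (deriv (deriv C.center) s) (C.e₁ s)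
    (C.e₂ s) (deriv C.e₁ s) (deriv C.e₂ s) (deriv (deriv C.e₁) s) (deriv (deriv C.e₂) s)
    (C.radius s) (deriv C.radius s) (deriv (deriv C.radius) s)).eq_zero
    (fun θ => laplacian_eq_zero hC hs θ)
  rw [isotropic_horizontal_sq h₁ h₂ h₁₂] at hl
  have hr : (C.radius s : ℂ) ≠ 0 := by exact_mod_cast (C.radius_pos s hs).ne'
  exact twist_eq_zero h₁ h₂ h₁₂ k₁ k₂ k₁₂ l₁ l₂ l₁₂ (by simpa [hr, h] using hl)

/-- The derivative of n₃ is a combination of the vertical components of e₁ and e₂ with the angular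
velocities as coefficients. On a horizontal circle the former vanish, on any other the latter. This
avoids any discussion of the set of horizontal circles. -/
theorem normal_vertical_const (hC : C.IsAnisotropicMinimal) {t : ℝ} (hs : s ∈ C.I) (ht : t ∈ C.I) :
    C.normal s 2 = C.normal t 2 := by
  refine C.interval.eq_of_hasDerivAt_zero (f := fun s => C.normal s 2) (fun x hx => ?_) hs ht
  refine (HasDerivAt.coord (hasDerivAt_normal hx) 2).congr_deriv ?_
  by_cases h : isotropic (C.e₁ x) (C.e₂ x) 2 = 0
  · obtain ⟨a, b⟩ := isotropic_eq_zero h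
    simp [a, b]
  · obtain ⟨a, b⟩ := twist_eq_zero_of_not_horizontal hC hx h
    simp [a, b]

/-- The planes of the circles are all horizontal, or none is. -/
theorem horizontal_or_not (hC : C.IsAnisotropicMinimal) :
    (∀ s ∈ C.I, C.e₁ s 2 = 0 ∧ C.e₂ s 2 = 0) ∨
      ∀ s ∈ C.I, isotropic (C.e₁ s) (C.e₂ s) 2 ≠ 0 := by
  by_contra hcon
  push Not at hcon
  obtain ⟨⟨s, hs, hs'⟩, t, ht, ht'⟩ := hcon
  obtain ⟨h₁, h₂, h₁₂⟩ := inner_frame hs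
  obtain ⟨k₁, k₂, k₁₂⟩ := inner_frame ht
  have a := normal_vertical_sq h₁ h₂ h₁₂
  have b := normal_vertical_sq k₁ k₂ k₁₂
  obtain ⟨u, v⟩ := isotropic_eq_zero ht'
  have hn : cross (C.e₁ s) (C.e₂ s) 2 = cross (C.e₁ t) (C.e₂ t) 2 :=
    normal_vertical_const hC hs ht
  rw [u, v, ← hn] at b
  -- The horizontal circle at t gives n₃² = 1, and n₃ has the same value at s.
  have x : C.e₁ s 2 = 0 := by nlinarith [sq_nonneg (C.e₁ s 2), sq_nonneg (C.e₂ s 2)]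
  exact hs' x (by nlinarith [sq_nonneg (C.e₁ s 2), sq_nonneg (C.e₂ s 2)])

/-- The planes of the circles are parallel. -/
theorem twist_eq_zero (hC : C.IsAnisotropicMinimal) (hs : s ∈ C.I) :
    ⟪deriv C.e₁ s, C.normal s⟫ = 0 ∧ ⟪deriv C.e₂ s, C.normal s⟫ = 0 := by
  rcases horizontal_or_not hC with h | h
  · have hI := C.interval.1
    have a := hasDerivAt_of_eqOn_const
      (HasDerivAt.coord (hasDerivAt_of_smooth C.e₁_smooth hI hs) 2) hI hs (fun t ht => (h t ht).1)
    have b := hasDerivAt_of_eqOn_const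
      (HasDerivAt.coord (hasDerivAt_of_smooth C.e₂_smooth hI hs) 2) hI hs (fun t ht => (h t ht).2)
    obtain ⟨u, v⟩ := h s hs
    simp [normal, inner_coord, a, b, u, v]
  · exact twist_eq_zero_of_not_horizontal hC hs (h s hs)

theorem normal_const (hC : C.IsAnisotropicMinimal) {t : ℝ} (hs : s ∈ C.I) (ht : t ∈ C.I) :
    C.normal s = C.normal t := by
  refine C.interval.eq_of_hasDerivAt_zero (fun x hx => ?_) hs ht
  refine (hasDerivAt_normal hx).congr_deriv ?_
  obtain ⟨a, b⟩ := twist_eq_zero hC hx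
  simp [a, b]

theorem frame_deriv_eq (hC : C.IsAnisotropicMinimal) (hs : s ∈ C.I) :
    deriv C.e₁ s = ⟪deriv C.e₁ s, C.e₂ s⟫ • C.e₂ s ∧
      deriv C.e₂ s = -(⟪deriv C.e₁ s, C.e₂ s⟫ • C.e₁ s) := by
  obtain ⟨h₁, h₂, h₁₂⟩ := inner_frame hs
  obtain ⟨k₁, k₂, k₁₂⟩ := inner_frame_deriv hs
  obtain ⟨a, b⟩ := twist_eq_zero hC hs
  rw [normal] at a b
  have d₁ := frame_decomp h₁ h₂ h₁₂ (deriv C.e₁ s)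
  have d₂ := frame_decomp h₁ h₂ h₁₂ (deriv C.e₂ s)
  rw [k₁, a] at d₁
  rw [k₂, b, eq_neg_of_add_eq_zero_right k₁₂] at d₂
  constructor
  · simpa using d₁
  · simpa using d₂

theorem parallelLaplacian_eq_zero (hC : C.IsAnisotropicMinimal) (hs : s ∈ C.I) (θ : ℝ) :
    parallelLaplacian (deriv C.center s) (deriv (deriv C.center) s) (C.e₁ s) (C.e₂ s)
      (C.radius s) (deriv C.radius s) (deriv (deriv C.radius) s) θ = 0 := by
  have hI := C.interval.1
  obtain ⟨h₁, h₂, h₁₂⟩ := inner_frame hs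
  obtain ⟨l₁, l₂, l₁₂⟩ := inner_frame_deriv_deriv hs
  obtain ⟨a, b⟩ := frame_deriv_eq hC hs
  have h₂₁ : ⟪C.e₂ s, C.e₁ s⟫ = 0 := by rw [real_inner_comm, h₁₂]
  have hn : HasDerivAt C.normal 0 s := by
    obtain ⟨x, y⟩ := twist_eq_zero hC hs
    simpa [x, y] using hasDerivAt_normal hs
  -- Differentiating ⟨eᵢ', n⟩ = 0 with n' = 0 shows that the second derivatives of the frame also
  -- stay in the plane.
  have n₁ := hasDerivAt_of_eqOn_const
    ((hasDerivAt_of_smooth (smooth_deriv C.e₁_smooth hI) hI hs).inner ℝ hn) hI hs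
    (fun t ht => (twist_eq_zero hC ht).1)
  have n₂ := hasDerivAt_of_eqOn_const
    ((hasDerivAt_of_smooth (smooth_deriv C.e₂_smooth hI) hI hs).inner ℝ hn) hI hs
    (fun t ht => (twist_eq_zero hC ht).2)
  rw [inner_zero_right, zero_add, normal] at n₁ n₂
  have g₁ := frame_decomp h₁ h₂ h₁₂ (deriv (deriv C.e₁) s)
  have g₂ := frame_decomp h₁ h₂ h₁₂ (deriv (deriv C.e₂) s)
  have hL := laplacian_eq_zero hC hs θ
  rw [laplacian] at hL
  generalize ⟪deriv C.e₁ s, C.e₂ s⟫ = w at *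
  simp only [a, b] at l₁ l₂ l₁₂
  rw [a, b] at hL
  simp only [real_inner_smul_left, real_inner_smul_right, inner_neg_left, inner_neg_right,
    h₁, h₂, h₂₁] at l₁ l₂ l₁₂
  generalize ⟪deriv (deriv C.e₁) s, C.e₂ s⟫ = k at *
  have x₁ : ⟪deriv (deriv C.e₁) s, C.e₁ s⟫ = -w ^ 2 := by linarith
  have x₂ : ⟪deriv (deriv C.e₂) s, C.e₂ s⟫ = -w ^ 2 := by linarith
  have x₁₂ : ⟪deriv (deriv C.e₂) s, C.e₁ s⟫ = -k := by linarith
  rw [x₁, n₁] at g₁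
  rw [x₂, x₁₂, n₂] at g₂
  have g₁' : deriv (deriv C.e₁) s = -w ^ 2 • C.e₁ s + k • C.e₂ s := by
    rw [g₁]; module
  have g₂' : deriv (deriv C.e₂) s = -(k • C.e₁ s) - w ^ 2 • C.e₂ s := by
    rw [g₂]; module
  rw [g₁', g₂', circleLaplacian_of_parallel h₁ h₂ h₁₂] at hL
  exact (mul_eq_zero.1 hL).resolve_left (pow_ne_zero 2 (C.radius_pos s hs).ne')

/-- Density in use: an open condition on s that holds at one parameter also holds at one with ν₃ ≠
0. -/
theorem regular_mem_of_eventually (hC : C.IsAnisotropicMinimal) (hs : s ∈ C.I) (θ : ℝ)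
    {P : ℝ → Prop} (hP : ∀ᶠ t in nhds s, P t) : ∃ q ∈ C.regular, P q.1 := by
  have hmem : (s, θ) ∈ closure C.regular := hC.1 ⟨hs, trivial⟩
  obtain ⟨q, hq, hq'⟩ := ((mem_closure_iff_frequently.1 hmem).and_eventually
    (continuousAt_fst.eventually hP)).exists
  exact ⟨q, hq, hq'⟩

/-- If the planes moved at s they would move at a nearby regular parameter. There the surface is to
first order a vertical translate of a circle, so X_s × X_θ is horizontal, a contradiction. -/
theorem inner_normal_center (hC : C.IsAnisotropicMinimal)
    (h : ∀ s ∈ C.I, isotropic (C.e₁ s) (C.e₂ s) 2 ≠ 0) (hs : s ∈ C.I) :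
    ⟪C.normal s, deriv C.center s⟫ = 0 := by
  have hI := C.interval.1
  by_contra hne
  have hcont : ContinuousAt (fun t => ⟪C.normal t, deriv C.center t⟫) s :=
    (hasDerivAt_normal hs).continuousAt.inner
      (hasDerivAt_of_smooth (smooth_deriv C.center_smooth hI) hI hs).continuousAt
  obtain ⟨⟨t, θ⟩, hq, hq'⟩ := regular_mem_of_eventually hC hs 0 (hcont.eventually_ne hne)
  have ht : t ∈ C.I := hq.1
  obtain ⟨h₁, h₂, h₁₂⟩ := inner_frame ht
  obtain ⟨r₁, c0, c1⟩ := vertical_translation_of_parallelLaplacian h₁ h₂ h₁₂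
    (C.radius_pos t ht).ne' (h t ht) hq' (parallelLaplacian_eq_zero hC ht)
  refine (unitNormal_two_ne_zero_iff ht).1 hq.2 ?_
  obtain ⟨a, b⟩ := frame_deriv_eq hC ht
  rw [a, b, r₁, tangentS, tangentθ]
  simp [rot_apply, c0, c1]
  ring

theorem isInclinedPlanePiece (hC : C.IsAnisotropicMinimal)
    (h : ∀ s ∈ C.I, isotropic (C.e₁ s) (C.e₂ s) 2 ≠ 0) : IsInclinedPlanePiece C.carrier := by
  refine ⟨⟨C, rfl⟩, ?_⟩
  have hI := C.interval.1
  obtain ⟨s₀, hs₀⟩ := C.interval.2.2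
  have hcenter : ∀ s ∈ C.I, ⟪C.normal s₀, C.center s⟫ = ⟪C.normal s₀, C.center s₀⟫ := by
    intro s hs
    refine C.interval.eq_of_hasDerivAt_zero (f := fun s => ⟪C.normal s₀, C.center s⟫)
      (fun x hx => ?_) hs hs₀
    refine ((hasDerivAt_const x (C.normal s₀)).inner ℝ
      (hasDerivAt_of_smooth C.center_smooth hI hx)).congr_deriv ?_
    rw [normal_const hC hs₀ hx, inner_normal_center hC h hx]
    simp
  have hort : ∀ s ∈ C.I, ⟪C.normal s₀, C.e₁ s⟫ = 0 ∧ ⟪C.normal s₀, C.e₂ s⟫ = 0 := by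
    intro s hs
    rw [normal_const hC hs₀ hs, normal]
    constructor <;> simp only [inner_coord, cross_zero, cross_one, cross_two] <;> ring
  obtain ⟨h₁, h₂, h₁₂⟩ := inner_frame hs₀
  -- In a vertical plane both tangent vectors are orthogonal to n, so X_s × X_θ is a multiple of n
  -- and ν₃ = 0 everywhere, against density.
  have hz : C.normal s₀ 2 ≠ 0 := by
    intro hz
    obtain ⟨⟨t, θ⟩, hq, -⟩ := regular_mem_of_eventually hC hs₀ 0
      (P := fun _ => True) (Filter.Eventually.of_forall fun _ => trivial)
    have ht : t ∈ C.I := hq.1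
    refine (unitNormal_two_ne_zero_iff ht).1 hq.2 ?_
    obtain ⟨h₁, h₂, h₁₂⟩ := inner_frame ht
    obtain ⟨a, b⟩ := frame_deriv_eq hC ht
    have hc := inner_normal_center hC h ht
    rw [normal_const hC hs₀ ht] at hz
    rw [normal] at hc hz
    have o₁ : ⟪C.e₁ t, cross (C.e₁ t) (C.e₂ t)⟫ = 0 := by
      simp only [inner_coord, cross_zero, cross_one, cross_two]; ring
    have o₂ : ⟪C.e₂ t, cross (C.e₁ t) (C.e₂ t)⟫ = 0 := by
      simp only [inner_coord, cross_zero, cross_one, cross_two]; ring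
    rw [a, b, cross_eq_smul_normal h₁ h₂ h₁₂, PiLp.smul_apply, hz, smul_zero]
    · simp only [tangentS, rot, inner_add_left, inner_neg_left, real_inner_smul_left, o₁, o₂,
        real_inner_comm (cross _ _) (deriv C.center t), hc]
      simp
    · simp only [tangentθ, rot, inner_add_left, inner_neg_left, real_inner_smul_left, o₁, o₂]
      simp
  refine ⟨-(C.normal s₀ 0 / C.normal s₀ 2), -(C.normal s₀ 1 / C.normal s₀ 2),
    ⟪C.normal s₀, C.center s₀⟫ / C.normal s₀ 2, ?_, ?_⟩
  · intro heq
    simp only [Prod.mk.injEq, neg_eq_zero, div_eq_zero_iff, hz, or_false] at heq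
    have hn := (cross_frame h₁ h₂ h₁₂).2.2
    have hv := normal_vertical_sq h₁ h₂ h₁₂
    rw [norm_sq_coord] at hn
    change C.normal s₀ 0 ^ 2 + C.normal s₀ 1 ^ 2 + C.normal s₀ 2 ^ 2 = 1 at hn
    change C.normal s₀ 2 ^ 2 + _ + _ = 1 at hv
    rw [heq.1, heq.2] at hn
    apply h s₀ hs₀
    have x : C.e₁ s₀ 2 = 0 := by nlinarith [sq_nonneg (C.e₁ s₀ 2), sq_nonneg (C.e₂ s₀ 2)]
    have y : C.e₂ s₀ 2 = 0 := by nlinarith [sq_nonneg (C.e₁ s₀ 2), sq_nonneg (C.e₂ s₀ 2)]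
    simp [isotropic, x, y]
  · rintro p ⟨s, hs, θ, rfl⟩
    have : ⟪C.normal s₀, C.X s θ⟫ = ⟪C.normal s₀, C.center s₀⟫ := by
      simp only [X, circleFamily, inner_add_right, real_inner_smul_right, (hort s hs).1,
        (hort s hs).2, hcenter s hs]
      ring
    rw [← this, inner_coord]
    field_simp
    ring

end CyclicSurface

/-! ### Horizontal circles: the differential equations and the horizontal plane. -/

theorem exists_cos_sin_eq {p q : ℝ} (h : p ^ 2 + q ^ 2 = 1) :
    ∃ θ : ℝ, Real.cos θ = p ∧ Real.sin θ = q := by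
  have hn : ‖(⟨p, q⟩ : ℂ)‖ = 1 := by
    rw [Complex.norm_def, Complex.normSq_mk, Real.sqrt_eq_one]; linarith
  refine ⟨Complex.arg ⟨p, q⟩, ?_, ?_⟩
  · rw [Complex.cos_arg (by intro h0; rw [h0] at hn; simp at hn), hn, div_one]
  · rw [Complex.sin_arg, hn, div_one]

/-- A horizontal orthonormal frame parametrizes the horizontal unit circle. -/
theorem exists_rot_eq {e₁ e₂ : E3} (h₁ : ⟪e₁, e₁⟫ = 1) (h₂ : ⟪e₂, e₂⟫ = 1) (h₁₂ : ⟪e₁, e₂⟫ = 0)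
    (z₁ : e₁ 2 = 0) (z₂ : e₂ 2 = 0) {x y : ℝ} (h : x ^ 2 + y ^ 2 = 1) :
    ∃ θ, rot e₁ e₂ θ = !₂[x, y, 0] := by
  have hd := frame_decomp h₁ h₂ h₁₂ !₂[x, y, 0]
  have hn : ⟪(!₂[x, y, 0] : E3), cross e₁ e₂⟫ = 0 := by simp [inner_coord, z₁, z₂]
  have h₂₁ : ⟪e₂, e₁⟫ = 0 := by rw [real_inner_comm, h₁₂]
  rw [hn, zero_smul, add_zero] at hd
  have hpq : ⟪(!₂[x, y, 0] : E3), e₁⟫ ^ 2 + ⟪(!₂[x, y, 0] : E3), e₂⟫ ^ 2 = 1 := by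
    have hs : ⟪(!₂[x, y, 0] : E3), !₂[x, y, 0]⟫ = 1 := by rw [inner_coord, ← h]; simp; ring
    rw [← hs]
    conv_rhs => rw [hd]
    simp only [inner_add_left, inner_add_right, real_inner_smul_left, real_inner_smul_right,
      h₁, h₂, h₁₂, h₂₁]
    ring
  obtain ⟨θ, hc, hs⟩ := exists_cos_sin_eq hpq
  exact ⟨θ, by rw [rot, hc, hs]; exact hd.symm⟩

theorem rot_horizontal {e₁ e₂ : E3} (h₁ : ⟪e₁, e₁⟫ = 1) (h₂ : ⟪e₂, e₂⟫ = 1) (h₁₂ : ⟪e₁, e₂⟫ = 0)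
    (z₁ : e₁ 2 = 0) (z₂ : e₂ 2 = 0) (θ : ℝ) :
    ∃ φ, rot e₁ e₂ θ = !₂[Real.cos φ, Real.sin φ, 0] := by
  have hE := (inner_rot_rot h₁ h₂ h₁₂ θ).1
  have hz : rot e₁ e₂ θ 2 = 0 := by simp [rot_apply, z₁, z₂]
  rw [inner_coord, hz] at hE
  obtain ⟨φ, hc, hs⟩ := exists_cos_sin_eq (p := rot e₁ e₂ θ 0) (q := rot e₁ e₂ θ 1) (by linarith)
  exact ⟨φ, by rw [hc, hs]; apply E3.ext' <;> simp [hz]⟩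

/-- The equation for circles in horizontal planes. -/
theorem horizontal_equations {e₁ e₂ : E3} (h₁ : ⟪e₁, e₁⟫ = 1) (h₂ : ⟪e₂, e₂⟫ = 1)
    (h₁₂ : ⟪e₁, e₂⟫ = 0) (z₁ : e₁ 2 = 0) (z₂ : e₂ 2 = 0) {c₁ c₂ : E3} {r r₁ r₂ : ℝ}
    (h : ∀ θ, parallelLaplacian c₁ c₂ e₁ e₂ r r₁ r₂ θ = 0) :
    r * (r₁ * c₂ 2 - c₁ 2 * r₂) + c₁ 2 * (c₁ 0 ^ 2 + c₁ 1 ^ 2 + r₁ ^ 2) = 0 ∧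
      r * (c₂ 2 * c₁ 0 - c₁ 2 * c₂ 0) + 2 * r₁ * c₁ 2 * c₁ 0 = 0 ∧
      r * (c₂ 2 * c₁ 1 - c₁ 2 * c₂ 1) + 2 * r₁ * c₁ 2 * c₁ 1 = 0 := by
  have hn : cross e₁ e₂ 2 ≠ 0 := by
    intro hn
    have := normal_vertical_sq h₁ h₂ h₁₂
    rw [hn, z₁, z₂] at this
    norm_num at this
  have key : ∀ x y : ℝ, x ^ 2 + y ^ 2 = 1 →
      r * (c₂ 2 * (c₁ 0 * x + c₁ 1 * y + r₁) - c₁ 2 * (c₂ 0 * x + c₂ 1 * y + r₂)) +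
        c₁ 2 * ((c₁ 0 + r₁ * x) ^ 2 + (c₁ 1 + r₁ * y) ^ 2) = 0 := by
    intro x y hxy
    obtain ⟨θ, hθ⟩ := exists_rot_eq h₁ h₂ h₁₂ z₁ z₂ hxy
    have hp := h θ
    have hT : horizontalInner (rot e₂ (-e₁) θ) (rot e₂ (-e₁) θ) = 1 := by
      have := (inner_rot_rot h₁ h₂ h₁₂ θ).2.1
      have hz : rot e₂ (-e₁) θ 2 = 0 := by simp [rot_apply, z₁, z₂]
      rw [inner_coord, hz] at this
      rw [horizontalInner]; linarith
    have hnc : ∀ c : E3, ⟪cross e₁ e₂, c⟫ = cross e₁ e₂ 2 * c 2 := by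
      intro c; simp [inner_coord, z₁, z₂]
    rw [parallelLaplacian, hT, hnc, hnc, hθ] at hp
    apply (mul_eq_zero.1 (_ : cross e₁ e₂ 2 * _ = 0)).resolve_left hn
    rw [← hp]
    simp only [inner_coord, horizontalInner, PiLp.add_apply, PiLp.smul_apply, smul_eq_mul]
    simp
    ring
  -- On the unit circle x² + y² = 1 makes the expression affine in (x, y), so four points determine
  -- its three coefficients.
  have k1 := key 1 0 (by norm_num)
  have k2 := key (-1) 0 (by norm_num)
  have k3 := key 0 1 (by norm_num)
  have k4 := key 0 (-1) (by norm_num)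
  refine ⟨?_, ?_, ?_⟩ <;> linarith

/-- Uniqueness against the zero solution; continuity of g at s alone bounds it near s and gives the
Lipschitz constant. -/
theorem eventually_eq_zero_of_linear_ode {y g : ℝ → ℝ} {s : ℝ} (hg : ContinuousAt g s)
    (h : ∀ᶠ t in nhds s, HasDerivAt y (g t * y t) t) (h0 : y s = 0) :
    ∀ᶠ t in nhds s, y t = 0 := by
  have hb : ∀ᶠ t in nhds s, ‖g t‖ < ‖g s‖ + 1 :=
    hg.norm.eventually_lt_const (by linarith)
  obtain ⟨ε, hε, hball⟩ := Metric.eventually_nhds_iff_ball.1 (hb.and h)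
  rw [Real.ball_eq_Ioo] at hball
  have hK : (0 : ℝ) ≤ ‖g s‖ + 1 := by positivity
  have := ODE_solution_unique_of_mem_Ioo (v := fun t x => g t * x) (s := fun _ => Set.univ)
    (K := ⟨‖g s‖ + 1, hK⟩) (f := y) (g := fun _ => (0 : ℝ)) (a := s - ε) (b := s + ε) (t₀ := s)
    (fun t ht => by
      refine (LipschitzWith.of_dist_le_mul fun x x' => ?_).lipschitzOnWith
      rw [Real.dist_eq, Real.dist_eq, ← mul_sub, abs_mul]
      exact mul_le_mul_of_nonneg_right (hball t ht).1.le (abs_nonneg _))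
    ⟨by linarith, by linarith⟩
    (fun t ht => ⟨(hball t ht).2, trivial⟩)
    (fun t ht => ⟨by simpa using hasDerivAt_const t (0 : ℝ), trivial⟩) h0
  filter_upwards [Ioo_mem_nhds (show s - ε < s by linarith) (show s < s + ε by linarith)] with t ht
    using this ht

namespace CyclicSurface

variable {C : CyclicSurface} {s : ℝ}

/-- If the circle of parameter `s` is horizontal and moves horizontally, then its radius
changes. -/
theorem deriv_radius_ne_zero (hC : C.IsAnisotropicMinimal) (hs : s ∈ C.I)
    (h : C.e₁ s 2 = 0 ∧ C.e₂ s 2 = 0) (hz : deriv C.center s 2 = 0) : deriv C.radius s ≠ 0 := by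
  intro hr
  obtain ⟨h₁, h₂, h₁₂⟩ := inner_frame hs
  have h₂₁ : ⟪C.e₂ s, C.e₁ s⟫ = 0 := by rw [real_inner_comm, h₁₂]
  obtain ⟨a, b⟩ := frame_deriv_eq hC hs
  have hli := C.immersion s hs
  change ∀ θ, LinearIndependent ℝ ![ds C.X s θ, dθ C.X s θ] at hli
  -- A vector in the plane of the circle is tangent to it at some angle. With r' = 0, there X_s is
  -- parallel to X_θ, so the immersion fails.
  obtain ⟨θ, k, hk⟩ : ∃ θ k : ℝ, deriv C.center s = k • rot (C.e₂ s) (-C.e₁ s) θ := by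
    by_cases h0 : deriv C.center s = 0
    · exact ⟨0, 0, by rw [h0, zero_smul]⟩
    · have hl : ‖deriv C.center s‖ ≠ 0 := norm_ne_zero_iff.2 h0
      have hsq := norm_sq_coord (deriv C.center s)
      rw [hz] at hsq
      obtain ⟨θ, hθ⟩ := exists_rot_eq (e₁ := C.e₂ s) (e₂ := -C.e₁ s) h₂ (by simpa using h₁)
        (by simpa using h₂₁) h.2 (by simp [h.1]) (x := deriv C.center s 0 / ‖deriv C.center s‖)
        (y := deriv C.center s 1 / ‖deriv C.center s‖) (by field_simp; linarith)
      refine ⟨θ, ‖deriv C.center s‖, ?_⟩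
      rw [hθ]
      apply E3.ext'
      · simp; field_simp
      · simp; field_simp
      · simp [hz]
  have hl := hli θ
  rw [ds_X hs, dθ_X, LinearIndependent.pair_iff] at hl
  generalize ⟪deriv C.e₁ s, C.e₂ s⟫ = w at *
  have := hl (C.radius s) (-(k + C.radius s * w)) (by
    rw [a, b, tangentS, tangentθ, hr, hk]
    have : rot (w • C.e₂ s) (-(w • C.e₁ s)) θ = w • rot (C.e₂ s) (-C.e₁ s) θ := by
      simp only [rot]; module
    rw [this]; module)
  exact (C.radius_pos s hs).ne' this.1

/-- A horizontal circle moving horizontally stays in its plane. -/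
theorem isHorizontalPlanePiece (hC : C.IsAnisotropicMinimal)
    (h : ∀ s ∈ C.I, C.e₁ s 2 = 0 ∧ C.e₂ s 2 = 0) (hs : s ∈ C.I) (hz : deriv C.center s 2 = 0) :
    IsHorizontalPlanePiece C.carrier := by
  refine ⟨⟨C, rfl⟩, C.center s 2, ?_⟩
  have hI := C.interval.1
  have hloc : ∀ t ∈ C.I, deriv C.center t 2 = 0 → ∀ᶠ x in nhds t, deriv C.center x 2 = 0 := by
    intro t ht ht0
    have hc1 := fun i => HasDerivAt.coord
      (hasDerivAt_of_smooth (smooth_deriv C.center_smooth hI) hI ht) i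
    have hr0 := hasDerivAt_of_smooth C.radius_smooth hI ht
    have hr1 := hasDerivAt_of_smooth (smooth_deriv C.radius_smooth hI) hI ht
    have hr2 := hasDerivAt_of_smooth (smooth_deriv (smooth_deriv C.radius_smooth hI) hI) hI ht
    have hne := deriv_radius_ne_zero hC ht (h t ht) ht0
    -- The radial equation solved for z'' as g z'; the division is allowed because r' ≠ 0 near t.
    refine eventually_eq_zero_of_linear_ode (g := fun x => (C.radius x * deriv (deriv C.radius) x -
      (deriv C.center x 0 ^ 2 + deriv C.center x 1 ^ 2 + deriv C.radius x ^ 2)) /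
      (C.radius x * deriv C.radius x)) ?_ ?_ ht0
    · refine ContinuousAt.div ?_ ?_ (mul_ne_zero (C.radius_pos t ht).ne' hne)
      · exact (hr0.continuousAt.mul hr2.continuousAt).sub
          ((((hc1 0).continuousAt.pow 2).add ((hc1 1).continuousAt.pow 2)).add
            (hr1.continuousAt.pow 2))
      · exact hr0.continuousAt.mul hr1.continuousAt
    · filter_upwards [hI.mem_nhds ht, hr1.continuousAt.eventually_ne hne] with x hx hx'
      refine (HasDerivAt.coord
        (hasDerivAt_of_smooth (smooth_deriv C.center_smooth hI) hI hx) 2).congr_deriv ?_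
      obtain ⟨h₁, h₂, h₁₂⟩ := inner_frame hx
      have := (horizontal_equations h₁ h₂ h₁₂ (h x hx).1 (h x hx).2
        (parallelLaplacian_eq_zero hC hx)).1
      have hr := (C.radius_pos x hx).ne'
      field_simp
      linarith
  -- The set where z' vanishes locally is open, and relatively closed in I by continuity of z' and
  -- `hloc`; I is connected.
  have hall : C.I ⊆ {t | ∀ᶠ x in nhds t, deriv C.center x 2 = 0} := by
    refine C.interval.2.1.isPreconnected.subset_of_closure_inter_subset
      isOpen_setOfPred_eventually_nhds ⟨s, hs, hloc s hs hz⟩ ?_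
    rintro t ⟨ht, htI⟩
    apply hloc t htI
    by_contra hne
    have hc := (HasDerivAt.coord
      (hasDerivAt_of_smooth (smooth_deriv C.center_smooth hI) hI htI) 2).continuousAt
    obtain ⟨x, hx, hx'⟩ := ((mem_closure_iff_frequently.1 ht).and_eventually
      (hc.eventually_ne hne)).exists
    exact hx' hx.self_of_nhds
  rintro p ⟨t, ht, θ, rfl⟩
  have hconst := C.interval.eq_of_hasDerivAt_zero (f := fun x => C.center x 2) (fun x hx =>
    (HasDerivAt.coord (hasDerivAt_of_smooth C.center_smooth hI hx) 2).congr_deriv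
      (hall hx).self_of_nhds) ht hs
  simp [X, circleFamily, (h t ht).1, (h t ht).2, hconst]

/-- A cyclic surface with horizontal circles as a point set. -/
theorem carrier_eq_of_horizontal (h : ∀ s ∈ C.I, C.e₁ s 2 = 0 ∧ C.e₂ s 2 = 0) :
    C.carrier = {p | ∃ s ∈ C.I, ∃ θ : ℝ,
      p = C.center s + C.radius s • !₂[Real.cos θ, Real.sin θ, 0]} := by
  ext p
  constructor
  · rintro ⟨s, hs, θ, rfl⟩
    obtain ⟨h₁, h₂, h₁₂⟩ := inner_frame hs
    obtain ⟨φ, hφ⟩ := rot_horizontal h₁ h₂ h₁₂ (h s hs).1 (h s hs).2 θ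
    exact ⟨s, hs, φ, by rw [← hφ]; rfl⟩
  · rintro ⟨s, hs, θ, rfl⟩
    obtain ⟨h₁, h₂, h₁₂⟩ := inner_frame hs
    obtain ⟨φ, hφ⟩ := exists_rot_eq h₁ h₂ h₁₂ (h s hs).1 (h s hs).2 (Real.cos_sq_add_sin_sq θ)
    exact ⟨s, hs, φ, by rw [← hφ]; rfl⟩

end CyclicSurface

/-! ### Integration of the profile equations. -/

theorem IsOpenInterval.image {I : Set ℝ} (hI : IsOpenInterval I) {f f' : ℝ → ℝ}
    (hf : ContDiffOn ℝ ∞ f I) (hf' : ∀ s ∈ I, HasDerivAt f (f' s) s) (h0 : ∀ s ∈ I, f' s ≠ 0) :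
    IsOpenInterval (f '' I) := by
  refine ⟨?_, ?_, hI.2.2.image f⟩
  · rw [isOpen_iff_mem_nhds]
    rintro _ ⟨s, hs, rfl⟩
    have hst : HasStrictDerivAt f (f' s) s :=
      (hf.contDiffAt (hI.1.mem_nhds hs)).hasStrictDerivAt' (hf' s hs) (by simp)
    rw [← hst.map_nhds_eq (h0 s hs)]
    exact Filter.image_mem_map (hI.1.mem_nhds hs)
  · exact (hI.2.1.isPreconnected.image f hf.continuousOn).ordConnected

/-- Solutions of `y' = z' v`, `v' = z' (v² - k²) / y`, regarded as functions of `z`. -/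
theorem classify_profile {I : Set ℝ} (hI : IsOpenInterval I) {y v z z' : ℝ → ℝ} {k : ℝ}
    (hk : 0 < k) (hy0 : ∀ s ∈ I, y s ≠ 0) (hz : ∀ s ∈ I, HasDerivAt z (z' s) s)
    (hy : ∀ s ∈ I, HasDerivAt y (z' s * v s) s)
    (hv : ∀ s ∈ I, HasDerivAt v (z' s * (v s ^ 2 - k ^ 2) / y s) s) :
    (∃ c t : ℝ, c ≠ 0 ∧ ∀ s ∈ I, y s = k / c * Real.cos (c * (z s - t)) ∧
      v s = -(k * Real.sin (c * (z s - t)))) ∨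
    (∃ ε t : ℝ, (ε = 1 ∨ ε = -1) ∧ ∀ s ∈ I, y s = ε * (k * (z s - t) + 1) ∧ v s = ε * k) ∨
    (∃ ε c t : ℝ, (ε = 1 ∨ ε = -1) ∧ c ≠ 0 ∧ ∀ s ∈ I,
      y s = ε * (k / c * Real.sinh (c * (z s - t))) ∧
      v s = ε * (k * Real.cosh (c * (z s - t)))) := by
  obtain ⟨s₀, hs₀⟩ := hI.2.2
  -- The first integral: (v² - k²)/y² is constant. It makes the system linear, d²y/dz² = κ y.
  obtain ⟨κ, hκ⟩ : ∃ κ : ℝ, ∀ s ∈ I, v s ^ 2 - k ^ 2 = κ * y s ^ 2 := by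
    refine ⟨(v s₀ ^ 2 - k ^ 2) / y s₀ ^ 2, fun s hs => ?_⟩
    have : (v s ^ 2 - k ^ 2) / y s ^ 2 = (v s₀ ^ 2 - k ^ 2) / y s₀ ^ 2 := by
      refine hI.eq_of_hasDerivAt_zero (f := fun s => (v s ^ 2 - k ^ 2) / y s ^ 2)
        (fun x hx => ?_) hs hs₀
      have h0 := hy0 x hx
      refine ((((hv x hx).pow 2).sub_const (k ^ 2)).div ((hy x hx).pow 2)
        (pow_ne_zero 2 h0)).congr_deriv ?_
      simp only [Pi.pow_apply]
      field_simp
      ring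
    rw [← this]
    have h0 := hy0 s hs
    field_simp
  have hv' : ∀ s ∈ I, HasDerivAt v (κ * z' s * y s) s := fun s hs =>
    (hv s hs).congr_deriv (by rw [hκ s hs]; have := hy0 s hs; field_simp)
  rcases lt_trichotomy κ 0 with hneg | rfl | hpos
  · left
    obtain ⟨c, hc, rfl⟩ : ∃ c : ℝ, c ≠ 0 ∧ κ = -c ^ 2 :=
      ⟨√(-κ), (Real.sqrt_pos.2 (by linarith)).ne', by rw [Real.sq_sqrt (by linarith)]; ring⟩
    have hcos : ∀ s ∈ I, HasDerivAt (fun s => Real.cos (c * z s))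
        (-Real.sin (c * z s) * (c * z' s)) s := fun s hs => ((hz s hs).const_mul c).cos
    have hsin : ∀ s ∈ I, HasDerivAt (fun s => Real.sin (c * z s))
        (Real.cos (c * z s) * (c * z' s)) s := fun s hs => ((hz s hs).const_mul c).sin
    -- P and Q are the components of (c y, v) rotated back by the angle c z. Their length is k, and
    -- their polar angle φ gives the shift t = φ/c.
    obtain ⟨P, hP⟩ : ∃ P : ℝ, ∀ s ∈ I,
        c * y s * Real.cos (c * z s) - v s * Real.sin (c * z s) = P :=
      ⟨_, fun s hs => hI.eq_of_hasDerivAt_zero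
        (f := fun s => c * y s * Real.cos (c * z s) - v s * Real.sin (c * z s))
        (fun x hx => ((((hy x hx).const_mul c).mul (hcos x hx)).sub
          ((hv' x hx).mul (hsin x hx))).congr_deriv (by ring)) hs hs₀⟩
    obtain ⟨Q, hQ⟩ : ∃ Q : ℝ, ∀ s ∈ I,
        c * y s * Real.sin (c * z s) + v s * Real.cos (c * z s) = Q :=
      ⟨_, fun s hs => hI.eq_of_hasDerivAt_zero
        (f := fun s => c * y s * Real.sin (c * z s) + v s * Real.cos (c * z s))
        (fun x hx => ((((hy x hx).const_mul c).mul (hsin x hx)).add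
          ((hv' x hx).mul (hcos x hx))).congr_deriv (by ring)) hs hs₀⟩
    have hPQ : P ^ 2 + Q ^ 2 = k ^ 2 := by
      rw [← hP s₀ hs₀, ← hQ s₀ hs₀]
      linear_combination (c ^ 2 * y s₀ ^ 2 + v s₀ ^ 2) * Real.sin_sq_add_cos_sq (c * z s₀) +
        hκ s₀ hs₀
    obtain ⟨φ, hcφ, hsφ⟩ := exists_cos_sin_eq (p := P / k) (q := Q / k) (by
      field_simp; linarith)
    refine ⟨c, φ / c, hc, fun s hs => ?_⟩
    have e : c * (z s - φ / c) = c * z s - φ := by field_simp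
    have h1 := Real.sin_sq_add_cos_sq (c * z s)
    rw [e, Real.cos_sub, Real.sin_sub, hcφ, hsφ, ← hP s hs, ← hQ s hs]
    constructor
    · field_simp
      linear_combination (-(c * y s)) * h1
    · field_simp
      linear_combination (-(v s)) * h1
  · right; left
    obtain ⟨w, hw⟩ : ∃ w : ℝ, ∀ s ∈ I, v s = w :=
      ⟨_, fun s hs => hI.eq_of_hasDerivAt_zero (f := v)
        (fun x hx => (hv' x hx).congr_deriv (by ring)) hs hs₀⟩
    obtain ⟨d, hd⟩ : ∃ d : ℝ, ∀ s ∈ I, y s - w * z s = d :=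
      ⟨_, fun s hs => hI.eq_of_hasDerivAt_zero (f := fun s => y s - w * z s)
        (fun x hx => ((hy x hx).sub ((hz x hx).const_mul w)).congr_deriv
          (by rw [hw x hx]; ring)) hs hs₀⟩
    have hwk : w ^ 2 = k ^ 2 := by
      have := hκ s₀ hs₀
      rw [hw s₀ hs₀] at this
      linarith
    obtain ⟨ε, hε, rfl⟩ : ∃ ε : ℝ, (ε = 1 ∨ ε = -1) ∧ w = ε * k := by
      rcases sq_eq_sq_iff_eq_or_eq_neg.1 hwk with rfl | rfl
      · exact ⟨1, Or.inl rfl, by ring⟩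
      · exact ⟨-1, Or.inr rfl, by ring⟩
    have hεε : ε * ε = 1 := by rcases hε with rfl | rfl <;> norm_num
    -- The shift t is chosen so that the additive constant of the linear profile is 1, as type II
    -- requires a nonzero one.
    refine ⟨ε, (1 - ε * d) / k, hε, fun s hs => ⟨?_, hw s hs⟩⟩
    have := hd s hs
    field_simp
    linear_combination this - d * hεε
  · right; right
    obtain ⟨c, hc, rfl⟩ : ∃ c : ℝ, c ≠ 0 ∧ κ = c ^ 2 :=
      ⟨√κ, (Real.sqrt_pos.2 hpos).ne', by rw [Real.sq_sqrt hpos.le]⟩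
    -- v + c y is proportional to e^{cz}, and v - c y follows from (v + c y)(v - c y) = k². The
    -- factor |K|/k is absorbed into the shift of z, and the sign of K becomes ε.
    obtain ⟨K, hK⟩ : ∃ K : ℝ, ∀ s ∈ I, (v s + c * y s) * Real.exp (-(c * z s)) = K :=
      ⟨_, fun s hs => hI.eq_of_hasDerivAt_zero
        (f := fun s => (v s + c * y s) * Real.exp (-(c * z s)))
        (fun x hx => (((hv' x hx).add ((hy x hx).const_mul c)).mul
          ((hz x hx).const_mul c).neg.exp).congr_deriv (by simp only [Pi.add_apply]; ring)) hs hs₀⟩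
    have hK0 : K ≠ 0 := by
      rintro rfl
      have h1 := (mul_eq_zero.1 (hK s₀ hs₀)).resolve_right (Real.exp_ne_zero _)
      have h2 := hκ s₀ hs₀
      have : k ^ 2 = 0 := by linear_combination (v s₀ - c * y s₀) * h1 - h2
      exact hk.ne' (pow_eq_zero_iff (two_ne_zero) |>.1 this)
    obtain ⟨ε, hε, hKε⟩ : ∃ ε : ℝ, (ε = 1 ∨ ε = -1) ∧ K = ε * |K| := by
      rcases abs_choice K with h | h
      · exact ⟨1, Or.inl rfl, by rw [h]; ring⟩
      · exact ⟨-1, Or.inr rfl, by rw [h]; ring⟩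
    have hεε : ε * ε = 1 := by rcases hε with rfl | rfl <;> norm_num
    have hKp : 0 < |K| / k := div_pos (abs_pos.2 hK0) hk
    refine ⟨ε, c, -(Real.log (|K| / k) / c), hε, hc, fun s hs => ?_⟩
    have e : c * (z s - -(Real.log (|K| / k) / c)) = c * z s + Real.log (|K| / k) := by
      field_simp; ring
    have hp : Real.exp (c * (z s - -(Real.log (|K| / k) / c))) =
        Real.exp (c * z s) * (|K| / k) := by
      rw [e, Real.exp_add, Real.exp_log hKp]
    have hm : Real.exp (-(c * (z s - -(Real.log (|K| / k) / c)))) =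
        (Real.exp (c * z s) * (|K| / k))⁻¹ := by
      rw [Real.exp_neg, hp]
    have hpl : v s + c * y s = ε * k * (Real.exp (c * z s) * (|K| / k)) := by
      have := hK s hs
      rw [Real.exp_neg, hKε] at this
      have h0 := Real.exp_ne_zero (c * z s)
      field_simp at this ⊢
      linarith
    have hmi : v s - c * y s = ε * k * (Real.exp (c * z s) * (|K| / k))⁻¹ := by
      have h2 := hκ s hs
      have h0 : Real.exp (c * z s) * (|K| / k) ≠ 0 :=
        mul_ne_zero (Real.exp_ne_zero _) hKp.ne'
      generalize Real.exp (c * z s) * (|K| / k) = E at *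
      have h3 : ε * k * E ≠ 0 := by
        refine mul_ne_zero (mul_ne_zero ?_ hk.ne') h0
        rintro rfl
        norm_num at hεε
      apply mul_left_cancel₀ h3
      rw [← hpl]
      have : (v s + c * y s) * (ε * k * E⁻¹) = k ^ 2 := by
        rw [hpl]; field_simp; linear_combination hεε
      rw [this]; linarith
    rw [Real.sinh_eq, Real.cosh_eq, hp, hm]
    generalize Real.exp (c * z s) * (|K| / k) = E at *
    constructor
    · rw [show y s = ((v s + c * y s) - (v s - c * y s)) / (2 * c) by field_simp; ring, hpl, hmi]
      field_simp
    · rw [show v s = ((v s + c * y s) + (v s - c * y s)) / 2 by ring, hpl, hmi]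
      ring

/-- Reparametrization by the height τ. A negative profile radius describes the same circle with θ
replaced by θ + π, which accounts for the sign ε. -/
theorem setOf_circles_eq_horizontalCircles {I : Set ℝ} {center : ℝ → E3} {r τ α β ρ : ℝ → ℝ}
    {v : E3} {ε : ℝ} (hε : ε = 1 ∨ ε = -1)
    (hc : ∀ s ∈ I, center s = v + !₂[α (τ s), β (τ s), τ s])
    (hr : ∀ s ∈ I, r s = ε * ρ (τ s)) :
    {p | ∃ s ∈ I, ∃ θ : ℝ, p = center s + r s • !₂[Real.cos θ, Real.sin θ, 0]} =
      horizontalCircles v (τ '' I) α β ρ := by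
  ext p
  constructor
  · rintro ⟨s, hs, θ, rfl⟩
    refine ⟨τ s, ⟨s, hs, rfl⟩, ?_⟩
    rcases hε with rfl | rfl
    · exact ⟨θ, by rw [hc s hs, hr s hs, one_mul, add_assoc]⟩
    · refine ⟨θ + Real.pi, ?_⟩
      rw [hc s hs, hr s hs]
      apply E3.ext' <;> simp [add_assoc]
  · rintro ⟨_, ⟨s, hs, rfl⟩, θ, rfl⟩
    refine ⟨s, hs, ?_⟩
    rcases hε with rfl | rfl
    · exact ⟨θ, by rw [hc s hs, hr s hs, one_mul, add_assoc]⟩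
    · refine ⟨θ + Real.pi, ?_⟩
      rw [hc s hs, hr s hs]
      apply E3.ext' <;> simp [add_assoc]

theorem smooth_coord {f : ℝ → E3} {I : Set ℝ} (hf : ContDiffOn ℝ ∞ f I) (i : Fin 3) :
    ContDiffOn ℝ ∞ (fun s => f s i) I :=
  contDiffOn_euclidean.1 hf i

theorem IsOpenInterval.exists_eq_const {I : Set ℝ} (hI : IsOpenInterval I) {f : ℝ → ℝ}
    (h : ∀ s ∈ I, HasDerivAt f 0 s) : ∃ k, ∀ s ∈ I, f s = k := by
  obtain ⟨s₀, hs₀⟩ := hI.2.2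
  exact ⟨f s₀, fun s hs => hI.eq_of_hasDerivAt_zero h hs hs₀⟩

namespace CyclicSurface

variable {C : CyclicSurface}

/-- With a' = b' = 0 the radial equation says that r'/(z' r) is constant, so z is an affine function
of log r. -/
theorem isLogarithmicRevolution (hC : C.IsAnisotropicMinimal)
    (h : ∀ s ∈ C.I, C.e₁ s 2 = 0 ∧ C.e₂ s 2 = 0) (hz : ∀ s ∈ C.I, deriv C.center s 2 ≠ 0)
    (ha : ∀ s ∈ C.I, deriv C.center s 0 = 0) (hb : ∀ s ∈ C.I, deriv C.center s 1 = 0) :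
    IsLogarithmicRevolution C.carrier := by
  have hI := C.interval
  have hcen := fun i s (hs : s ∈ C.I) =>
    HasDerivAt.coord (hasDerivAt_of_smooth C.center_smooth hI.1 hs) i
  have hcen' := fun i s (hs : s ∈ C.I) =>
    HasDerivAt.coord (hasDerivAt_of_smooth (smooth_deriv C.center_smooth hI.1) hI.1 hs) i
  have hr := fun s (hs : s ∈ C.I) => hasDerivAt_of_smooth C.radius_smooth hI.1 hs
  have hr' := fun s (hs : s ∈ C.I) =>
    hasDerivAt_of_smooth (smooth_deriv C.radius_smooth hI.1) hI.1 hs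
  obtain ⟨k, hk⟩ := hI.exists_eq_const
    (f := fun s => deriv C.radius s / (deriv C.center s 2 * C.radius s)) (fun s hs => by
      have h0 := hz s hs
      have r0 := (C.radius_pos s hs).ne'
      refine ((hr' s hs).div ((hcen' 2 s hs).mul (hr s hs)) (mul_ne_zero h0 r0)).congr_deriv ?_
      obtain ⟨h₁, h₂, h₁₂⟩ := inner_frame hs
      have e := (horizontal_equations h₁ h₂ h₁₂ (h s hs).1 (h s hs).2
        (parallelLaplacian_eq_zero hC hs)).1
      rw [ha s hs, hb s hs] at e
      rw [div_eq_zero_iff]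
      left
      simp only [Pi.mul_apply]
      linear_combination -e)
  have hrk : ∀ s ∈ C.I, deriv C.radius s = k * (deriv C.center s 2 * C.radius s) := by
    intro s hs
    have h0 := hz s hs
    have r0 := (C.radius_pos s hs).ne'
    rw [← hk s hs]
    field_simp
  -- For k = 0 the surface is a vertical cylinder, whose normal is horizontal everywhere.
  have hk0 : k ≠ 0 := by
    rintro rfl
    obtain ⟨s₀, hs₀⟩ := hI.2.2
    obtain ⟨⟨t, θ⟩, hq, -⟩ := regular_mem_of_eventually hC hs₀ 0
      (P := fun _ => True) (Filter.Eventually.of_forall fun _ => trivial)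
    have ht : t ∈ C.I := hq.1
    refine (unitNormal_two_ne_zero_iff ht).1 hq.2 ?_
    obtain ⟨x, y⟩ := frame_deriv_eq hC ht
    rw [x, y, hrk t ht, tangentS, tangentθ]
    simp [rot_apply, ha t ht, hb t ht]
    ring
  obtain ⟨a₀, ha₀⟩ := hI.exists_eq_const (f := fun s => C.center s 0) (fun s hs =>
    (hcen 0 s hs).congr_deriv (ha s hs))
  obtain ⟨b₀, hb₀⟩ := hI.exists_eq_const (f := fun s => C.center s 1) (fun s hs =>
    (hcen 1 s hs).congr_deriv (hb s hs))
  obtain ⟨z₀, hz₀⟩ := hI.exists_eq_const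
    (f := fun s => C.center s 2 - k⁻¹ * Real.log (C.radius s)) (fun s hs => by
      have r0 := (C.radius_pos s hs).ne'
      refine ((hcen 2 s hs).sub (((hr s hs).log r0).const_mul k⁻¹)).congr_deriv ?_
      rw [hrk s hs]
      field_simp
      ring)
  refine ⟨k⁻¹, inv_ne_zero hk0, C.radius '' C.I, hI.image C.radius_smooth hr (fun s hs => ?_), ?_,
    !₂[a₀, b₀, z₀], ?_⟩
  · rw [hrk s hs]
    exact mul_ne_zero hk0 (mul_ne_zero (hz s hs) (C.radius_pos s hs).ne')
  · rintro _ ⟨s, hs, rfl⟩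
    exact C.radius_pos s hs
  · rw [carrier_eq_of_horizontal h]
    have key : ∀ s ∈ C.I, ∀ θ : ℝ, C.center s + C.radius s • !₂[Real.cos θ, Real.sin θ, 0] =
        !₂[a₀, b₀, z₀] + !₂[C.radius s * Real.cos θ, C.radius s * Real.sin θ,
          k⁻¹ * Real.log (C.radius s)] := by
      intro s hs θ
      have := hz₀ s hs
      apply E3.ext'
      · simp [ha₀ s hs]
      · simp [hb₀ s hs]
      · simp; linarith
    ext p
    constructor
    · rintro ⟨s, hs, θ, rfl⟩
      exact ⟨_, ⟨s, hs, rfl⟩, θ, key s hs θ⟩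
    · rintro ⟨_, ⟨s, hs, rfl⟩, θ, rfl⟩
      exact ⟨s, hs, θ, (key s hs θ).symm⟩

theorem classify_horizontal (hC : C.IsAnisotropicMinimal)
    (h : ∀ s ∈ C.I, C.e₁ s 2 = 0 ∧ C.e₂ s 2 = 0) (hz : ∀ s ∈ C.I, deriv C.center s 2 ≠ 0) :
    IsLogarithmicRevolution C.carrier ∨ IsTypeI C.carrier ∨ IsTypeII C.carrier ∨
      IsTypeIII C.carrier := by
  have hI := C.interval
  have hcen := fun i s (hs : s ∈ C.I) =>
    HasDerivAt.coord (hasDerivAt_of_smooth C.center_smooth hI.1 hs) i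
  have hcen' := fun i s (hs : s ∈ C.I) =>
    HasDerivAt.coord (hasDerivAt_of_smooth (smooth_deriv C.center_smooth hI.1) hI.1 hs) i
  have hr := fun s (hs : s ∈ C.I) => hasDerivAt_of_smooth C.radius_smooth hI.1 hs
  have hr' := fun s (hs : s ∈ C.I) =>
    hasDerivAt_of_smooth (smooth_deriv C.radius_smooth hI.1) hI.1 hs
  have heq := fun s (hs : s ∈ C.I) => horizontal_equations (inner_frame hs).1
    (inner_frame hs).2.1 (inner_frame hs).2.2 (h s hs).1 (h s hs).2
    (parallelLaplacian_eq_zero hC hs)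
  -- The equation for a coordinate of the centre says that its derivative divided by z' r² is
  -- constant.
  have hfirst : ∀ i : Fin 3, (∀ s ∈ C.I, C.radius s * (deriv (deriv C.center) s 2 *
      deriv C.center s i - deriv C.center s 2 * deriv (deriv C.center) s i) +
      2 * deriv C.radius s * deriv C.center s 2 * deriv C.center s i = 0) →
      ∃ l, ∀ s ∈ C.I, deriv C.center s i = l * deriv C.center s 2 * C.radius s ^ 2 := by
    intro i hi
    obtain ⟨l, hl⟩ := hI.exists_eq_const
      (f := fun s => deriv C.center s i / (deriv C.center s 2 * C.radius s ^ 2)) (fun s hs => by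
        have h0 := hz s hs
        have r0 := (C.radius_pos s hs).ne'
        refine ((hcen' i s hs).div ((hcen' 2 s hs).mul ((hr s hs).pow 2))
          (mul_ne_zero h0 (pow_ne_zero 2 r0))).congr_deriv ?_
        rw [div_eq_zero_iff]
        left
        simp only [Pi.mul_apply, Pi.pow_apply]
        linear_combination (-C.radius s) * hi s hs)
    refine ⟨l, fun s hs => ?_⟩
    have h0 := hz s hs
    have r0 := (C.radius_pos s hs).ne'
    rw [← hl s hs]
    field_simp
  obtain ⟨l, hl⟩ := hfirst 0 (fun s hs => (heq s hs).2.1)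
  obtain ⟨m, hm⟩ := hfirst 1 (fun s hs => (heq s hs).2.2)
  by_cases hlm : l ^ 2 + m ^ 2 = 0
  · left
    have l0 : l = 0 := by nlinarith [sq_nonneg l, sq_nonneg m]
    have m0 : m = 0 := by nlinarith [sq_nonneg l, sq_nonneg m]
    exact isLogarithmicRevolution hC h hz (fun s hs => by rw [hl s hs, l0]; ring)
      (fun s hs => by rw [hm s hs, m0]; ring)
  right
  set k := √(l ^ 2 + m ^ 2) with hk
  have hkk : k ^ 2 = l ^ 2 + m ^ 2 := Real.sq_sqrt (by positivity)
  have hkp : 0 < k := Real.sqrt_pos.2 (lt_of_le_of_ne (by positivity) (Ne.symm hlm))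
  -- v is the derivative of y = 1/r with respect to the height z.
  set v : ℝ → ℝ := fun s => -(deriv C.radius s / (C.radius s ^ 2 * deriv C.center s 2)) with hvdef
  have hy : ∀ s ∈ C.I, HasDerivAt (fun s => (C.radius s)⁻¹) (deriv C.center s 2 * v s) s := by
    intro s hs
    have h0 := hz s hs
    have r0 := (C.radius_pos s hs).ne'
    refine ((hr s hs).fun_inv r0).congr_deriv ?_
    simp only [hvdef]
    field_simp
  have hv : ∀ s ∈ C.I, HasDerivAt v
      (deriv C.center s 2 * (v s ^ 2 - k ^ 2) / (C.radius s)⁻¹) s := by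
    intro s hs
    have h0 := hz s hs
    have r0 := (C.radius_pos s hs).ne'
    refine ((hr' s hs).div (((hr s hs).pow 2).mul (hcen' 2 s hs))
      (mul_ne_zero (pow_ne_zero 2 r0) h0)).neg.congr_deriv ?_
    have e := (heq s hs).1
    rw [hl s hs, hm s hs] at e
    simp only [hvdef, Pi.mul_apply, Pi.pow_apply, hkk]
    field_simp
    linear_combination C.radius s * e
  have hy0 : ∀ s ∈ C.I, (C.radius s)⁻¹ ≠ 0 := fun s hs => inv_ne_zero (C.radius_pos s hs).ne'
  -- The quotient v/y has z-derivative -k²/y² = -k² r², so it is a primitive of r² up to a factor,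
  -- and no separate integration is needed for each type.
  have hcenter : ∀ (i : Fin 3) (l : ℝ), (∀ s ∈ C.I, deriv C.center s i =
      l * deriv C.center s 2 * C.radius s ^ 2) →
      ∃ a₀, ∀ s ∈ C.I, C.center s i = a₀ - l / k ^ 2 * (v s / (C.radius s)⁻¹) := by
    intro i l hl
    obtain ⟨a₀, ha₀⟩ := hI.exists_eq_const
      (f := fun s => C.center s i + l / k ^ 2 * (v s / (C.radius s)⁻¹)) (fun s hs => by
        have r0 := (C.radius_pos s hs).ne'
        refine ((hcen i s hs).add (((hv s hs).div (hy s hs) (hy0 s hs)).const_mul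
          (l / k ^ 2))).congr_deriv ?_
        rw [hl s hs]
        have := hkp.ne'
        field_simp
        ring)
    exact ⟨a₀, fun s hs => by linarith [ha₀ s hs]⟩
  obtain ⟨a₀, ha₀⟩ := hcenter 0 l hl
  obtain ⟨b₀, hb₀⟩ := hcenter 1 m hm
  have hJ : ∀ t : ℝ, IsOpenInterval ((fun s => C.center s 2 - t) '' C.I) := fun t =>
    hI.image ((smooth_coord C.center_smooth 2).sub contDiffOn_const)
      (fun s hs => (hcen 2 s hs).sub_const t) hz
  have hrad : ∀ s, C.radius s = ((C.radius s)⁻¹)⁻¹ := fun s => (inv_inv _).symm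
  rcases classify_profile hI hkp hy0 (hcen 2) hy hv with
    ⟨c, t, hc, hs⟩ | ⟨ε, t, hε, hs⟩ | ⟨ε, c, t, hε, hc, hs⟩
  · left
    have hcos : ∀ s ∈ C.I, Real.cos (c * (C.center s 2 - t)) ≠ 0 := fun s hs' h0 =>
      hy0 s hs' (by rw [(hs s hs').1, h0, mul_zero])
    refine ⟨c, l, m, hc, hlm, _, hJ t, ?_, !₂[a₀, b₀, t], ?_⟩
    · rintro _ ⟨s, hs', rfl⟩
      exact hcos s hs'
    · rw [carrier_eq_of_horizontal h]
      refine setOf_circles_eq_horizontalCircles (Or.inl rfl) (fun s hs' => ?_) (fun s hs' => ?_)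
      · have h0 := hcos s hs'
        apply E3.ext'
        · simp only [ha₀ s hs', (hs s hs').1, (hs s hs').2, Real.tan_eq_sin_div_cos, ← hkk]
          simp
          field_simp
          ring
        · simp only [hb₀ s hs', (hs s hs').1, (hs s hs').2, Real.tan_eq_sin_div_cos, ← hkk]
          simp
          field_simp
          ring
        · simp
      · have h0 := hcos s hs'
        rw [hrad s, (hs s hs').1]
        simp only [← hk]
        field_simp
  · right; left
    have hεε : ε * ε = 1 := by rcases hε with rfl | rfl <;> norm_num
    have hε0 : ε ≠ 0 := by rintro rfl; norm_num at hεε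
    have hcos : ∀ s ∈ C.I, k * (C.center s 2 - t) + 1 ≠ 0 := fun s hs' h0 =>
      hy0 s hs' (by rw [(hs s hs').1, h0, mul_zero])
    -- The parameter c of type II can be taken to be 1, because the vertical translation by t
    -- absorbs it.
    refine ⟨1, l, m, one_ne_zero, hlm, _, hJ t, ?_, !₂[a₀, b₀, t], ?_⟩
    · rintro _ ⟨s, hs', rfl⟩
      exact hcos s hs'
    · rw [carrier_eq_of_horizontal h]
      refine setOf_circles_eq_horizontalCircles hε (fun s hs' => ?_) (fun s hs' => ?_)
      · have h0 := hcos s hs'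
        have h1 : k ^ 2 * (C.center s 2 - t) + 1 * k = k * (k * (C.center s 2 - t) + 1) := by ring
        apply E3.ext'
        · simp only [ha₀ s hs', (hs s hs').1, (hs s hs').2, ← hk]
          simp only [← hkk, h1]
          simp
          field_simp
          ring
        · simp only [hb₀ s hs', (hs s hs').1, (hs s hs').2, ← hk]
          simp only [← hkk, h1]
          simp
          field_simp
          ring
        · simp
      · have h0 := hcos s hs'
        rw [hrad s, (hs s hs').1]
        simp only [← hk]
        field_simp
        linear_combination -hεε
  · right; right
    have hεε : ε * ε = 1 := by rcases hε with rfl | rfl <;> norm_num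
    have hε0 : ε ≠ 0 := by rintro rfl; norm_num at hεε
    have hcos : ∀ s ∈ C.I, Real.sinh (c * (C.center s 2 - t)) ≠ 0 := fun s hs' h0 =>
      hy0 s hs' (by rw [(hs s hs').1, h0, mul_zero, mul_zero])
    refine ⟨c, l, m, hc, hlm, _, hJ t, ?_, !₂[a₀, b₀, t], ?_⟩
    · rintro _ ⟨s, hs', rfl⟩
      exact hcos s hs'
    · rw [carrier_eq_of_horizontal h]
      refine setOf_circles_eq_horizontalCircles hε (fun s hs' => ?_) (fun s hs' => ?_)
      · have h0 := hcos s hs'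
        apply E3.ext'
        · simp only [ha₀ s hs', (hs s hs').1, (hs s hs').2, ← hkk]
          simp
          field_simp
          ring
        · simp only [hb₀ s hs', (hs s hs').1, (hs s hs').2, ← hkk]
          simp
          field_simp
          ring
        · simp
      · have h0 := hcos s hs'
        rw [hrad s, (hs s hs').1]
        simp only [← hk]
        field_simp
        linear_combination -hεε

end CyclicSurface

/-! ### The converse: the listed surfaces are minimal. -/

theorem cross_ne_zero_of_linearIndependent {a b : E3} (h : LinearIndependent ℝ ![a, b]) :
    cross a b ≠ 0 := by
  intro h0
  rw [LinearIndependent.pair_iff] at h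
  have h1 : ⟪b, b⟫ • a + (-⟪a, b⟫) • b = cross b (cross a b) := by
    apply E3.ext' <;>
      simp only [inner_coord, cross_zero, cross_one, cross_two, PiLp.add_apply, PiLp.smul_apply,
        smul_eq_mul] <;> ring
  have h2 : cross b 0 = 0 := by apply E3.ext' <;> simp
  rw [h0, h2] at h1
  have hb := inner_self_eq_zero.1 (h _ _ h1).1
  exact one_ne_zero (h 0 1 (by rw [hb]; simp)).2

/-- The final `+ 0` gives the conclusion the shape of the hypothesis, so the lemma applies again to
the second derivatives. -/
theorem slope_deriv {f : ℝ → E3} {f' : E3} {t A B z₀ : ℝ} {I : Set ℝ} (hf : HasDerivAt f f' t)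
    (hI : IsOpen I) (ht : t ∈ I) (h : ∀ x ∈ I, f x 2 = A * f x 0 + B * f x 1 + z₀) :
    f' 2 = A * f' 0 + B * f' 1 + 0 := by
  have := CyclicSurface.hasDerivAt_of_eqOn_const (((HasDerivAt.coord hf 2).sub
    ((HasDerivAt.coord hf 0).const_mul A)).sub ((HasDerivAt.coord hf 1).const_mul B)) hI ht
    (a := z₀) (fun x hx => by simp only [Pi.sub_apply]; linarith [h x hx])
  linarith

/-- A cyclic surface in a plane that is not vertical is anisotropic minimal. -/
theorem CyclicSurface.isAnisotropicMinimal_of_plane {C : CyclicSurface} {A B z₀ : ℝ}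
    (h : ∀ p ∈ C.carrier, p 2 = A * p 0 + B * p 1 + z₀) : C.IsAnisotropicMinimal := by
  have hI := C.interval.1
  have hX : ∀ s ∈ C.I, ∀ θ, C.X s θ 2 = A * C.X s θ 0 + B * C.X s θ 1 + z₀ :=
    fun s hs θ => h _ ⟨s, hs, θ, rfl⟩
  have hs1 : ∀ s ∈ C.I, ∀ θ, ds C.X s θ 2 = A * ds C.X s θ 0 + B * ds C.X s θ 1 + 0 := by
    intro s hs θ
    have hd : HasDerivAt (fun t => C.X t θ) (ds C.X s θ) s := by
      refine DifferentiableAt.hasDerivAt ?_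
      exact ((hasDerivAt_of_smooth C.center_smooth hI hs).add
        ((hasDerivAt_of_smooth C.radius_smooth hI hs).smul
        (hasDerivAt_rot (hasDerivAt_of_smooth C.e₁_smooth hI hs)
          (hasDerivAt_of_smooth C.e₂_smooth hI hs) θ))).differentiableAt
    exact slope_deriv hd hI hs (fun x hx => hX x hx θ)
  have ht1 : ∀ s ∈ C.I, ∀ θ, dθ C.X s θ 2 = A * dθ C.X s θ 0 + B * dθ C.X s θ 1 + 0 := by
    intro s hs θ
    have hd : HasDerivAt (fun t => C.X s t) (dθ C.X s θ) θ := by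
      refine DifferentiableAt.hasDerivAt ?_
      exact (((hasDerivAt_rot_angle (C.e₁ s) (C.e₂ s) θ).const_smul (C.radius s)).const_add
        (C.center s)).differentiableAt
    exact slope_deriv hd isOpen_univ (Set.mem_univ θ) (fun x _ => hX s hs x)
  have hcross : ∀ s ∈ C.I, ∀ θ, cross (ds C.X s θ) (dθ C.X s θ) =
      cross (ds C.X s θ) (dθ C.X s θ) 2 • !₂[-A, -B, 1] := by
    intro s hs θ
    have x := hs1 s hs θ
    have y := ht1 s hs θ
    apply E3.ext' <;> simp [x, y] <;> ring
  have hreg : ∀ s ∈ C.I, ∀ θ, unitNormal C.X s θ 2 ≠ 0 := by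
    intro s hs θ
    have hne : cross (ds C.X s θ) (dθ C.X s θ) ≠ 0 :=
      cross_ne_zero_of_linearIndependent (C.immersion s hs θ)
    refine mul_ne_zero (inv_ne_zero (norm_ne_zero_iff.2 hne)) fun h0 => hne ?_
    rw [hcross s hs θ]
    exact (congrArg (fun x : ℝ => x • (!₂[-A, -B, 1] : E3)) h0).trans (zero_smul _ _)
  refine ⟨fun q hq => subset_closure ⟨hq.1, hreg q.1 hq.1 q.2⟩, ?_⟩
  rintro ⟨s, θ⟩ ⟨hs, hn⟩
  rw [DirichletCyclic.anisotropicMeanCurvature_eq_zero_iff (hasDerivAt_ds_s hs θ)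
    (hasDerivAt_ds_θ hs θ) (hasDerivAt_dθ_s hs θ) (hasDerivAt_dθ_θ s θ) hn]
  have a := slope_deriv (hasDerivAt_ds_s hs θ) hI hs (fun x hx => hs1 x hx θ)
  have b := slope_deriv (hasDerivAt_ds_θ hs θ) isOpen_univ (Set.mem_univ θ)
    (fun x _ => hs1 s hs x)
  have c := slope_deriv (hasDerivAt_dθ_θ (C := C) s θ) isOpen_univ (Set.mem_univ θ)
    (fun x _ => ht1 s hs x)
  -- All second derivatives are parallel to the plane, hence orthogonal to X_s × X_θ: every term of
  -- `heightLaplacian` vanishes.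
  have key : ∀ u : E3, u 2 = A * u 0 + B * u 1 + 0 →
      ⟪cross (ds C.X s θ) (dθ C.X s θ), u⟫ = 0 := by
    intro u hu
    rw [hcross s hs θ, real_inner_smul_left, inner_coord, hu]
    simp
    right
    ring
  rw [heightLaplacian, key _ a, key _ b, key _ c]
  ring

theorem horizontalCircles_neg (v : E3) (J : Set ℝ) (a b r : ℝ → ℝ) :
    horizontalCircles v J a b (fun s => -r s) = horizontalCircles v J a b r := by
  ext p
  constructor <;>
  · rintro ⟨s, hs, θ, rfl⟩
    refine ⟨s, hs, θ + Real.pi, ?_⟩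
    apply E3.ext' <;> simp

/-- If the function vanished near θ, so would its first two derivatives, forcing A = B = 0 and then
R = 0. -/
theorem dense_trig {A B R θ : ℝ} (h : A ^ 2 + B ^ 2 ≠ 0 ∨ R ≠ 0) :
    ∃ᶠ t in nhds θ, R + (A * Real.cos t + B * Real.sin t) ≠ 0 := by
  intro hev
  simp only [not_not] at hev
  have h0 := hev.self_of_nhds
  have hder : ∀ t, HasDerivAt (fun t => R + (A * Real.cos t + B * Real.sin t))
      (A * -Real.sin t + B * Real.cos t) t := fun t =>
    (((Real.hasDerivAt_cos t).const_mul A).add ((Real.hasDerivAt_sin t).const_mul B)).const_add R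
  have hder2 : HasDerivAt (fun t => A * -Real.sin t + B * Real.cos t)
      (A * -Real.cos θ + B * -Real.sin θ) θ :=
    ((Real.hasDerivAt_sin θ).neg.const_mul A).add ((Real.hasDerivAt_cos θ).const_mul B)
  have hev1 : ∀ᶠ t in nhds θ, A * -Real.sin t + B * Real.cos t = 0 := by
    filter_upwards [hev.eventually_nhds] with t ht
    exact (hder t).unique ((hasDerivAt_const t 0).congr_of_eventuallyEq ht)
  have h1 := hev1.self_of_nhds
  have h2 := hder2.unique ((hasDerivAt_const θ 0).congr_of_eventuallyEq hev1)
  have hAB : A ^ 2 + B ^ 2 = 0 := by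
    linear_combination (-(A ^ 2 + B ^ 2)) * Real.sin_sq_add_cos_sq θ +
      (-A * Real.sin θ + B * Real.cos θ) * h1 - (A * Real.cos θ + B * Real.sin θ) * h2
  rcases h with h | h
  · exact h hAB
  · exact h (by linarith)

/-- Horizontal circles solving the profile equations form an anisotropic minimal surface. -/
theorem isCyclicAnisotropicMinimal_of_profile_pos {J : Set ℝ} (hJ : IsOpenInterval J)
    {a b r r₁ : ℝ → ℝ} {l m : ℝ} (v : E3) (sa : ContDiffOn ℝ ∞ a J) (sb : ContDiffOn ℝ ∞ b J)
    (sr : ContDiffOn ℝ ∞ r J) (hpos : ∀ s ∈ J, 0 < r s)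
    (ha : ∀ s ∈ J, HasDerivAt a (l * r s ^ 2) s) (hb : ∀ s ∈ J, HasDerivAt b (m * r s ^ 2) s)
    (hr : ∀ s ∈ J, HasDerivAt r (r₁ s) s)
    (hr₁ : ∀ s ∈ J, HasDerivAt r₁ ((r₁ s ^ 2 + (l ^ 2 + m ^ 2) * r s ^ 4) / r s) s)
    (hne : ∀ s ∈ J, l ^ 2 + m ^ 2 ≠ 0 ∨ r₁ s ≠ 0) :
    IsCyclicAnisotropicMinimal (horizontalCircles v J a b r) := by
  have hcen : ∀ s ∈ J, HasDerivAt (fun s => v + !₂[a s, b s, s])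
      (!₂[l * r s ^ 2, m * r s ^ 2, 1] : E3) s := by
    intro s hs
    refine HasDerivAt.const_add v (hasDerivAt_of_coord fun i => ?_)
    fin_cases i
    · exact ha s hs
    · exact hb s hs
    · exact hasDerivAt_id s
  have hcen' : ∀ s ∈ J, HasDerivAt (fun s => (!₂[l * r s ^ 2, m * r s ^ 2, 1] : E3))
      (!₂[l * (2 * r s * r₁ s), m * (2 * r s * r₁ s), 0] : E3) s := by
    intro s hs
    have h2 : HasDerivAt (fun s => r s ^ 2) (2 * r s * r₁ s) s :=
      ((hr s hs).pow 2).congr_deriv (by simp)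
    refine hasDerivAt_of_coord fun i => ?_
    fin_cases i
    · exact h2.const_mul l
    · exact h2.const_mul m
    · exact hasDerivAt_const s 1
  have hE : ∀ θ : ℝ, Real.cos θ • (!₂[1, 0, 0] : E3) + Real.sin θ • (!₂[0, 1, 0] : E3) =
      !₂[Real.cos θ, Real.sin θ, 0] := by
    intro θ; apply E3.ext' <;> simp
  let C : CyclicSurface :=
    { I := J
      center := fun s => v + !₂[a s, b s, s]
      radius := r
      e₁ := fun _ => !₂[1, 0, 0]
      e₂ := fun _ => !₂[0, 1, 0]
      interval := hJ
      center_smooth := by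
        refine contDiffOn_const.add (contDiffOn_euclidean.2 fun i => ?_)
        fin_cases i
        · exact sa
        · exact sb
        · exact contDiffOn_id
      radius_smooth := sr
      e₁_smooth := contDiffOn_const
      e₂_smooth := contDiffOn_const
      radius_pos := hpos
      orthonormal := fun s _ => by
        rw [orthonormal_iff_ite]
        intro i j
        rw [inner_coord]
        fin_cases i <;> fin_cases j <;> simp
      immersion := by
        intro s hs θ
        have d1 : ds (circleFamily (fun s => v + !₂[a s, b s, s]) (fun _ => !₂[1, 0, 0])
            (fun _ => !₂[0, 1, 0]) r) s θ 2 = 1 := by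
          have := (hcen s hs).add ((hr s hs).smul_const
            (Real.cos θ • (!₂[1, 0, 0] : E3) + Real.sin θ • (!₂[0, 1, 0] : E3)))
          refine (congrArg (fun u : E3 => u 2) this.deriv).trans ?_
          rw [hE]
          simp
        have d2 : dθ (circleFamily (fun s => v + !₂[a s, b s, s]) (fun _ => !₂[1, 0, 0])
            (fun _ => !₂[0, 1, 0]) r) s θ = r s • !₂[-Real.sin θ, Real.cos θ, 0] := by
          have := ((hasDerivAt_rot_angle (!₂[1, 0, 0] : E3) !₂[0, 1, 0] θ).const_smul
            (r s)).const_add (v + !₂[a s, b s, s])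
          refine this.deriv.trans (congrArg (r s • ·) ?_)
          apply E3.ext' <;> simp [rot_apply]
        rw [LinearIndependent.pair_iff, d2]
        intro x y hxy
        have x0 : x = 0 := by
          have := congrArg (fun u : E3 => u 2) hxy
          simpa [d1] using this
        refine ⟨x0, ?_⟩
        have h0 := congrArg (fun u : E3 => u 0) hxy
        have h1 := congrArg (fun u : E3 => u 1) hxy
        simp [x0, (hpos s hs).ne'] at h0 h1
        by_contra hy
        have := Real.sin_sq_add_cos_sq θ
        rw [h0.resolve_left hy, h1.resolve_left hy] at this
        norm_num at this }
  have dcen : ∀ s ∈ J, deriv C.center s = !₂[l * r s ^ 2, m * r s ^ 2, 1] :=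
    fun s hs => (hcen s hs).deriv
  have drad : ∀ s ∈ J, deriv C.radius s = r₁ s := fun s hs => (hr s hs).deriv
  have de₁ : deriv C.e₁ = fun _ => 0 := deriv_const' _
  have de₂ : deriv C.e₂ = fun _ => 0 := deriv_const' _
  -- The vertical component of X_s × X_θ is r (r' + r² (l cos θ + m sin θ)), so for each fixed s
  -- regularity is dense in θ by `dense_trig`.
  have hN : ∀ s ∈ J, ∀ θ, unitNormal C.X s θ 2 ≠ 0 ↔
      r₁ s + (l * r s ^ 2 * Real.cos θ + m * r s ^ 2 * Real.sin θ) ≠ 0 := by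
    intro s hs θ
    rw [CyclicSurface.unitNormal_two_ne_zero_iff (C := C) hs, dcen s hs, drad s hs, de₁, de₂]
    have e : cross (tangentS !₂[l * r s ^ 2, m * r s ^ 2, 1] (C.e₁ s) (C.e₂ s) 0 0 (C.radius s)
        (r₁ s) θ) (tangentθ (C.e₁ s) (C.e₂ s) (C.radius s) θ) 2 =
        r s * (r₁ s + (l * r s ^ 2 * Real.cos θ + m * r s ^ 2 * Real.sin θ)) := by
      simp only [C, tangentS, tangentθ, cross_two, PiLp.add_apply, PiLp.smul_apply, rot_apply,
        smul_eq_mul]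
      simp
      linear_combination r s * r₁ s * Real.sin_sq_add_cos_sq θ
    rw [e, mul_ne_zero_iff, and_iff_right (hpos s hs).ne']
  refine ⟨C, ⟨?_, ?_⟩, ?_⟩
  · rintro ⟨s, θ⟩ ⟨hs, -⟩
    have hs : s ∈ J := hs
    rw [mem_closure_iff_frequently]
    have hf := dense_trig (A := l * r s ^ 2) (B := m * r s ^ 2) (R := r₁ s) (θ := θ) (by
      rcases hne s hs with h | h
      · left
        rw [show (l * r s ^ 2) ^ 2 + (m * r s ^ 2) ^ 2 = (l ^ 2 + m ^ 2) * r s ^ 4 by ring]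
        exact mul_ne_zero h (pow_ne_zero 4 (hpos s hs).ne')
      · exact Or.inr h)
    have hcont : Filter.Tendsto (fun t : ℝ => (s, t)) (nhds θ) (nhds (s, θ)) :=
      (Continuous.prodMk_right s).tendsto θ
    exact hcont.frequently (hf.mono fun t ht => ⟨hs, (hN s hs t).2 ht⟩)
  · rintro ⟨s, θ⟩ ⟨hs, hn⟩
    rw [CyclicSurface.anisotropicMeanCurvature_eq_zero_iff hs hn]
    have hs : s ∈ J := hs
    have ddcen : deriv (deriv C.center) s =
        !₂[l * (2 * r s * r₁ s), m * (2 * r s * r₁ s), 0] := by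
      refine ((hcen' s hs).congr_of_eventuallyEq ?_).deriv
      filter_upwards [hJ.1.mem_nhds hs] with t ht using dcen t ht
    have ddrad : deriv (deriv C.radius) s = (r₁ s ^ 2 + (l ^ 2 + m ^ 2) * r s ^ 4) / r s := by
      refine ((hr₁ s hs).congr_of_eventuallyEq ?_).deriv
      filter_upwards [hJ.1.mem_nhds hs] with t ht using drad t ht
    obtain ⟨h₁, h₂, h₁₂⟩ := CyclicSurface.inner_frame (C := C) hs
    have hp := circleLaplacian_of_parallel h₁ h₂ h₁₂ (deriv C.center s) (deriv (deriv C.center) s)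
      (C.radius s) (deriv C.radius s) (deriv (deriv C.radius) s) 0 0 θ
    simp only [zero_smul, neg_zero, ne_eq, OfNat.ofNat_ne_zero, not_false_eq_true, zero_pow,
      add_zero, sub_zero] at hp
    rw [CyclicSurface.laplacian, de₁, de₂, deriv_const, hp, dcen s hs, drad s hs, ddcen, ddrad,
      parallelLaplacian]
    have r0 := (hpos s hs).ne'
    simp only [C, inner_coord, horizontalInner, PiLp.add_apply, PiLp.smul_apply, rot_apply,
      smul_eq_mul, cross_zero, cross_one, cross_two]
    simp
    right
    field_simp
    linear_combination (-(r s ^ 4 * (l ^ 2 + m ^ 2)) -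
      2 * r s ^ 2 * r₁ s * (l * Real.cos θ + m * Real.sin θ)) * Real.sin_sq_add_cos_sq θ
  · ext p
    constructor
    · rintro ⟨s, hs, θ, rfl⟩
      refine ⟨s, hs, θ, ?_⟩
      rw [CyclicSurface.X, circleFamily, add_assoc, hE]
    · rintro ⟨s, hs, θ, rfl⟩
      refine ⟨s, hs, θ, ?_⟩
      rw [CyclicSurface.X, circleFamily, add_assoc, hE]

/-- A continuous r without zeros has one sign on the interval. If it is negative, -r describes the
same circles and solves the same equations with r₁ replaced by -r₁. -/
theorem isCyclicAnisotropicMinimal_of_profile {J : Set ℝ} (hJ : IsOpenInterval J)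
    {a b r r₁ : ℝ → ℝ} {l m : ℝ} (v : E3) (sa : ContDiffOn ℝ ∞ a J) (sb : ContDiffOn ℝ ∞ b J)
    (sr : ContDiffOn ℝ ∞ r J) (h0 : ∀ s ∈ J, r s ≠ 0)
    (ha : ∀ s ∈ J, HasDerivAt a (l * r s ^ 2) s) (hb : ∀ s ∈ J, HasDerivAt b (m * r s ^ 2) s)
    (hr : ∀ s ∈ J, HasDerivAt r (r₁ s) s)
    (hr₁ : ∀ s ∈ J, HasDerivAt r₁ ((r₁ s ^ 2 + (l ^ 2 + m ^ 2) * r s ^ 4) / r s) s)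
    (hne : ∀ s ∈ J, l ^ 2 + m ^ 2 ≠ 0 ∨ r₁ s ≠ 0) :
    IsCyclicAnisotropicMinimal (horizontalCircles v J a b r) := by
  by_cases hpos : ∀ s ∈ J, 0 < r s
  · exact isCyclicAnisotropicMinimal_of_profile_pos hJ v sa sb sr hpos ha hb hr hr₁ hne
  push Not at hpos
  obtain ⟨t, ht, htr⟩ := hpos
  have hneg : ∀ s ∈ J, 0 < -r s := by
    intro s hs
    by_contra hcon
    have hoc := (hJ.2.1.isPreconnected.image r sr.continuousOn).ordConnected
    obtain ⟨x, hx, hx0⟩ := hoc.out ⟨t, ht, rfl⟩ ⟨s, hs, rfl⟩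
      (show (0 : ℝ) ∈ Set.Icc (r t) (r s) from ⟨htr, by linarith⟩)
    exact h0 x hx hx0
  rw [← horizontalCircles_neg]
  refine isCyclicAnisotropicMinimal_of_profile_pos hJ v sa sb sr.neg hneg (l := l) (m := m)
    (r₁ := fun s => -r₁ s) (fun s hs => ?_) (fun s hs => ?_) (fun s hs => (hr s hs).neg)
    (fun s hs => ?_) (fun s hs => ?_)
  · rw [neg_sq]; exact ha s hs
  · rw [neg_sq]; exact hb s hs
  · refine (hr₁ s hs).neg.congr_deriv ?_
    have := h0 s hs
    field_simp
  · rw [neg_ne_zero]; exact hne s hs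

theorem IsTypeI.isCyclicAnisotropicMinimal {S : Set E3} (h : IsTypeI S) :
    IsCyclicAnisotropicMinimal S := by
  obtain ⟨c, l, m, hc, hlm, J, hJ, hcos, v, rfl⟩ := h
  have hk0 : √(l ^ 2 + m ^ 2) ≠ 0 := (Real.sqrt_ne_zero (by positivity)).2 hlm
  have hkk : √(l ^ 2 + m ^ 2) ^ 2 = l ^ 2 + m ^ 2 := Real.sq_sqrt (by positivity)
  generalize √(l ^ 2 + m ^ 2) = k at *
  rw [← hkk]
  have hsin' : ∀ s, HasDerivAt (fun s => Real.sin (c * s)) (Real.cos (c * s) * c) s := fun s =>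
    ((hasDerivAt_id s).const_mul c).sin.congr_deriv (by simp)
  have hcos' : ∀ s, HasDerivAt (fun s => Real.cos (c * s)) (-Real.sin (c * s) * c) s := fun s =>
    ((hasDerivAt_id s).const_mul c).cos.congr_deriv (by simp)
  have scos : ContDiffOn ℝ ∞ (fun s => Real.cos (c * s)) J :=
    (Real.contDiff_cos.comp (contDiff_const.mul contDiff_id)).contDiffOn
  have ssin : ContDiffOn ℝ ∞ (fun s => Real.sin (c * s)) J :=
    (Real.contDiff_sin.comp (contDiff_const.mul contDiff_id)).contDiffOn
  have hden : ∀ s ∈ J, k * Real.cos (c * s) ≠ 0 := fun s hs => mul_ne_zero hk0 (hcos s hs)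
  have hsm : ∀ l : ℝ, ContDiffOn ℝ ∞ (fun s => c * l * Real.tan (c * s) / k ^ 2) J := by
    intro l
    simp only [Real.tan_eq_sin_div_cos]
    exact (contDiffOn_const.mul (ssin.div scos hcos)).div_const _
  have hd : ∀ l : ℝ, ∀ s ∈ J, HasDerivAt (fun s => c * l * Real.tan (c * s) / k ^ 2)
      (l * (c / (k * Real.cos (c * s))) ^ 2) s := by
    intro l s hs
    have h0 := hcos s hs
    simp only [Real.tan_eq_sin_div_cos]
    refine ((((hsin' s).div (hcos' s) h0).const_mul (c * l)).div_const (k ^ 2)).congr_deriv ?_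
    field_simp
    linear_combination l * Real.sin_sq_add_cos_sq (c * s)
  refine isCyclicAnisotropicMinimal_of_profile hJ v (hsm l) (hsm m)
    (contDiffOn_const.div (contDiffOn_const.mul scos) hden)
    (fun s hs => div_ne_zero hc (hden s hs)) (hd l) (hd m)
    (r₁ := fun s => c ^ 2 * Real.sin (c * s) / (k * Real.cos (c * s) ^ 2)) (fun s hs => ?_)
    (fun s hs => ?_) (fun s hs => Or.inl hlm)
  · have h0 := hcos s hs
    refine (((hasDerivAt_const s c).div ((hcos' s).const_mul k) (hden s hs))).congr_deriv ?_
    field_simp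
    ring
  · have h0 := hcos s hs
    refine (((hsin' s).const_mul (c ^ 2)).div (((hcos' s).pow 2).const_mul k)
      (mul_ne_zero hk0 (pow_ne_zero 2 h0))).congr_deriv ?_
    rw [← hkk]
    simp only [Pi.pow_apply]
    field_simp
    linear_combination Real.cos (c * s) * Real.sin_sq_add_cos_sq (c * s)

theorem IsTypeII.isCyclicAnisotropicMinimal {S : Set E3} (h : IsTypeII S) :
    IsCyclicAnisotropicMinimal S := by
  obtain ⟨c, l, m, hc, hlm, J, hJ, hden, v, rfl⟩ := h
  have hk0 : √(l ^ 2 + m ^ 2) ≠ 0 := (Real.sqrt_ne_zero (by positivity)).2 hlm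
  have hkk : √(l ^ 2 + m ^ 2) ^ 2 = l ^ 2 + m ^ 2 := Real.sq_sqrt (by positivity)
  generalize √(l ^ 2 + m ^ 2) = k at *
  have hlin : ∀ s, HasDerivAt (fun s => k * s + c) k s := fun s =>
    (((hasDerivAt_id s).const_mul k).add_const c).congr_deriv (by simp)
  have slin : ContDiffOn ℝ ∞ (fun s => k * s + c) J :=
    ((contDiff_const.mul contDiff_id).add contDiff_const).contDiffOn
  have hfac : ∀ s, (l ^ 2 + m ^ 2) * s + c * k = k * (k * s + c) := fun s => by rw [← hkk]; ring
  simp only [hfac]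
  have hden' : ∀ s ∈ J, k * (k * s + c) ≠ 0 := fun s hs => mul_ne_zero hk0 (hden s hs)
  have hsm : ∀ l : ℝ, ContDiffOn ℝ ∞ (fun s => -(l / (k * (k * s + c)))) J := fun l =>
    (contDiffOn_const.div (contDiffOn_const.mul slin) hden').neg
  have hd : ∀ l : ℝ, ∀ s ∈ J, HasDerivAt (fun s => -(l / (k * (k * s + c))))
      (l * (1 / (k * s + c)) ^ 2) s := by
    intro l s hs
    have h0 := hden s hs
    refine ((hasDerivAt_const s l).div ((hlin s).const_mul k) (hden' s hs)).neg.congr_deriv ?_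
    field_simp
    ring
  refine isCyclicAnisotropicMinimal_of_profile hJ v (hsm l) (hsm m)
    (contDiffOn_const.div slin hden)
    (fun s hs => div_ne_zero one_ne_zero (hden s hs)) (hd l) (hd m)
    (r₁ := fun s => -(k / (k * s + c) ^ 2)) (fun s hs => ?_)
    (fun s hs => ?_) (fun s hs => Or.inl hlm)
  · have h0 := hden s hs
    refine ((hasDerivAt_const s (1 : ℝ)).div (hlin s) h0).congr_deriv ?_
    field_simp
    ring
  · have h0 := hden s hs
    refine ((hasDerivAt_const s k).div ((hlin s).pow 2) (pow_ne_zero 2 h0)).neg.congr_deriv ?_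
    rw [← hkk]
    simp only [Pi.pow_apply]
    field_simp
    ring

theorem IsTypeIII.isCyclicAnisotropicMinimal {S : Set E3} (h : IsTypeIII S) :
    IsCyclicAnisotropicMinimal S := by
  obtain ⟨c, l, m, hc, hlm, J, hJ, hsinh, v, rfl⟩ := h
  have hk0 : √(l ^ 2 + m ^ 2) ≠ 0 := (Real.sqrt_ne_zero (by positivity)).2 hlm
  have hkk : √(l ^ 2 + m ^ 2) ^ 2 = l ^ 2 + m ^ 2 := Real.sq_sqrt (by positivity)
  generalize √(l ^ 2 + m ^ 2) = k at *
  rw [← hkk]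
  have hsin' : ∀ s, HasDerivAt (fun s => Real.sinh (c * s)) (Real.cosh (c * s) * c) s := fun s =>
    ((hasDerivAt_id s).const_mul c).sinh.congr_deriv (by simp)
  have hcos' : ∀ s, HasDerivAt (fun s => Real.cosh (c * s)) (Real.sinh (c * s) * c) s := fun s =>
    ((hasDerivAt_id s).const_mul c).cosh.congr_deriv (by simp)
  have scos : ContDiffOn ℝ ∞ (fun s => Real.cosh (c * s)) J :=
    (Real.contDiff_cosh.comp (contDiff_const.mul contDiff_id)).contDiffOn
  have ssin : ContDiffOn ℝ ∞ (fun s => Real.sinh (c * s)) J :=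
    (Real.contDiff_sinh.comp (contDiff_const.mul contDiff_id)).contDiffOn
  have hden : ∀ s ∈ J, k * Real.sinh (c * s) ≠ 0 := fun s hs => mul_ne_zero hk0 (hsinh s hs)
  have hsm : ∀ l : ℝ, ContDiffOn ℝ ∞
      (fun s => -(c * l * (Real.cosh (c * s) / Real.sinh (c * s)) / k ^ 2)) J := fun l =>
    ((contDiffOn_const.mul (scos.div ssin hsinh)).div_const _).neg
  have hd : ∀ l : ℝ, ∀ s ∈ J, HasDerivAt
      (fun s => -(c * l * (Real.cosh (c * s) / Real.sinh (c * s)) / k ^ 2))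
      (l * (c / (k * Real.sinh (c * s))) ^ 2) s := by
    intro l s hs
    have h0 := hsinh s hs
    refine ((((hcos' s).div (hsin' s) h0).const_mul (c * l)).div_const
      (k ^ 2)).neg.congr_deriv ?_
    field_simp
    linear_combination l * Real.cosh_sq (c * s)
  refine isCyclicAnisotropicMinimal_of_profile hJ v (hsm l) (hsm m)
    (contDiffOn_const.div (contDiffOn_const.mul ssin) hden)
    (fun s hs => div_ne_zero hc (hden s hs)) (hd l) (hd m)
    (r₁ := fun s => -(c ^ 2 * Real.cosh (c * s) / (k * Real.sinh (c * s) ^ 2))) (fun s hs => ?_)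
    (fun s hs => ?_) (fun s hs => Or.inl hlm)
  · have h0 := hsinh s hs
    refine (((hasDerivAt_const s c).div ((hsin' s).const_mul k) (hden s hs))).congr_deriv ?_
    field_simp
    ring
  · have h0 := hsinh s hs
    refine (((hcos' s).const_mul (c ^ 2)).div (((hsin' s).pow 2).const_mul k)
      (mul_ne_zero hk0 (pow_ne_zero 2 h0))).neg.congr_deriv ?_
    rw [← hkk]
    simp only [Pi.pow_apply]
    field_simp
    linear_combination Real.sinh (c * s) * Real.cosh_sq (c * s)

theorem IsLogarithmicRevolution.isCyclicAnisotropicMinimal {S : Set E3}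
    (h : IsLogarithmicRevolution S) : IsCyclicAnisotropicMinimal S := by
  obtain ⟨c, hc, J, hJ, hJ0, v, rfl⟩ := h
  have hpos : ∀ s ∈ J, 0 < s := fun s hs => hJ0 hs
  have hlog : ∀ s ∈ J, HasDerivAt (fun ρ => c * Real.log ρ) (c * s⁻¹) s := fun s hs =>
    (Real.hasDerivAt_log (hpos s hs).ne').const_mul c
  have hJ' : IsOpenInterval ((fun ρ => c * Real.log ρ) '' J) :=
    hJ.image (contDiffOn_const.mul (Real.contDiffOn_log.mono fun s hs => (hpos s hs).ne')) hlog
      (fun s hs => mul_ne_zero hc (inv_ne_zero (hpos s hs).ne'))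
  have hexp : ∀ s, HasDerivAt (fun s => Real.exp (s / c)) (Real.exp (s / c) / c) s := fun s =>
    ((hasDerivAt_id s).div_const c).exp.congr_deriv (by simp [div_eq_mul_inv])
  -- Parametrized by height instead of radius, the surface has r = e^{s/c} and fixed centres, a
  -- profile with l = m = 0.
  have hrev : revolution v J (fun ρ => c * Real.log ρ) =
      horizontalCircles v ((fun ρ => c * Real.log ρ) '' J) (fun _ => 0) (fun _ => 0)
        (fun s => Real.exp (s / c)) := by
    have hρ : ∀ ρ ∈ J, Real.exp (c * Real.log ρ / c) = ρ := fun ρ hρ => by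
      rw [mul_div_cancel_left₀ _ hc, Real.exp_log (hpos ρ hρ)]
    ext p
    constructor
    · rintro ⟨ρ, h, θ, rfl⟩
      refine ⟨_, ⟨ρ, h, rfl⟩, θ, ?_⟩
      apply E3.ext' <;> simp [hρ ρ h]
    · rintro ⟨_, ⟨ρ, h, rfl⟩, θ, rfl⟩
      refine ⟨ρ, h, θ, ?_⟩
      apply E3.ext' <;> simp [hρ ρ h]
  rw [hrev]
  refine isCyclicAnisotropicMinimal_of_profile hJ' v (l := 0) (m := 0)
    (r₁ := fun s => Real.exp (s / c) / c) contDiffOn_const contDiffOn_const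
    (Real.contDiff_exp.comp (contDiff_id.div_const c)).contDiffOn
    (fun s _ => Real.exp_ne_zero _) (fun s _ => ?_) (fun s _ => ?_) (fun s _ => hexp s)
    (fun s _ => ?_) (fun s _ => Or.inr (div_ne_zero (Real.exp_ne_zero _) hc))
  · simpa using hasDerivAt_const s (0 : ℝ)
  · simpa using hasDerivAt_const s (0 : ℝ)
  · refine ((hexp s).div_const c).congr_deriv ?_
    have := Real.exp_ne_zero (s / c)
    field_simp
    ring

end DirichletCyclic

theorem corollary1p4 (S : Set DirichletCyclic.E3) :
    DirichletCyclic.IsCyclicAnisotropicMinimal S ↔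
      (DirichletCyclic.IsHorizontalPlanePiece S ∨ DirichletCyclic.IsLogarithmicRevolution S) ∨
      (DirichletCyclic.IsTypeI S ∨ DirichletCyclic.IsTypeII S ∨ DirichletCyclic.IsTypeIII S) ∨
      DirichletCyclic.IsInclinedPlanePiece S := by
  constructor
  · rintro ⟨C, hC, rfl⟩
    rcases DirichletCyclic.CyclicSurface.horizontal_or_not hC with h | h
    · by_cases hz : ∀ s ∈ C.I, deriv C.center s 2 ≠ 0
      · rcases DirichletCyclic.CyclicSurface.classify_horizontal hC h hz with h | h
        · exact Or.inl (Or.inr h)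
        · exact Or.inr (Or.inl h)
      · push Not at hz
        obtain ⟨s, hs, hz⟩ := hz
        exact Or.inl (Or.inl (DirichletCyclic.CyclicSurface.isHorizontalPlanePiece hC h hs hz))
    · exact Or.inr (Or.inr (DirichletCyclic.CyclicSurface.isInclinedPlanePiece hC h))
  · rintro ((⟨⟨C, rfl⟩, z₀, h⟩ | h) | (h | h | h) | ⟨⟨C, rfl⟩, A, B, z₀, -, h⟩)
    · exact ⟨C, DirichletCyclic.CyclicSurface.isAnisotropicMinimal_of_plane (A := 0) (B := 0) (z₀ := z₀)
        (fun p hp => by rw [h p hp]; ring), rfl⟩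
    · exact h.isCyclicAnisotropicMinimal
    · exact h.isCyclicAnisotropicMinimal
    · exact h.isCyclicAnisotropicMinimal
    · exact h.isCyclicAnisotropicMinimal
    · exact ⟨C, DirichletCyclic.CyclicSurface.isAnisotropicMinimal_of_plane h, rfl⟩
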